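/- Let $d\ge 2$ be an integer, let $\varkappa>0$ and $\gamma>0$, and let $\mathbb{H}^d(\varkappa)$ be the $d$-dimensional hyperbolic space of constant sectional curvature $-\varkappa$, with metric $d_\varkappa$ and $d$-dimensional Hausdorff measure $\mathcal{H}^d_\varkappa$ (normalised so that it is the Riemannian volume). Let $\eta$ be a stationary Poisson process on $\mathbb{H}^d(\varkappa)$ of intensity $\gamma$, that is, a random locally finite subset such that for every Borel set $B$ the number $|\eta\cap B|$ is Poisson distributed with mean $\gamma\,\mathcal{H}^d_\varkappa(B)$, and such that for pairwise disjoint Borel sets $B_1,\dots,B_k$ the random variables $|\eta\cap B_1|,\dots,|\eta\cap B_k|$ are independent. Fix a point $o\in\mathbb{H}^d(\varkappa)$. The radial spanning tree of $\eta$ is the graph with vertex set $\eta\cup\{o\}$ in which every vertex $x\neq o$ is joined by an edge to its radial nearest neighbour, i.e. to the vertex $y$ with $d_\varkappa(o,y)<d_\varkappa(o,x)$ that has minimal distance $d_\varkappa(x,y)$ to $x$. Let $\deg(o)\in\{0,1,2,\dots\}\cup\{\infty\}$ be the degree of $o$ in this graph, a random variable. For $k\in\mathbb{N}$ put $\omega_k=2\pi^{k/2}/\Gamma(k/2)$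 and $\kappa_k=\omega_k/k$. Then: (a) $\mathbb{E}[\deg(o)^n]<\infty$ for every $n\in\mathbb{N}$. (b) The expected degree is given by $$\mathbb{E}[\deg(o)]=\gamma\,\omega_d\,\varkappa^{-d/2}\int_0^\infty \sinh^{d-1}(r)\,\exp\!\left(-2\gamma\,\kappa_{d-1}\,\varkappa^{-d/2}\int_0^{r/2}\left[\frac{\cosh^2(r)}{\cosh^2(r-t)}-1\right]^{\frac{d-1}{2}}\mathrm{d}t\right)\mathrm{d}r,$$ where the outer integral is finite. (c) The degree of the origin is not almost surely bounded: $\mathbb{P}(\deg(o)\ge n)>0$ for every $n\in\mathbb{N}$. -/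

import Mathlib

open MeasureTheory ProbabilityTheory
open scoped ENNReal NNReal

noncomputable section

/-! ### Hyperbolic space: the upper half-space model -/

/-- The underlying set of the `d`-dimensional hyperbolic space of constant curvature `-ϰ`, in the
upper half-space model: the points of `ℝ^d` whose last coordinate is positive. -/
@[ext]
structure HyperbolicSpace (d : ℕ) [NeZero d] (ϰ : ℝ) where
  /-- the underlying point of `ℝ^d` -/
  point : EuclideanSpace ℝ (Fin d)
  height_pos' : 0 < point ⟨d - 1, Nat.sub_one_lt (NeZero.ne d)⟩

namespace HyperbolicSpace

variable {d : ℕ} [NeZero d] {ϰ : ℝ}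

/-- The last coordinate. -/
def height (x : HyperbolicSpace d ϰ) : ℝ := x.point ⟨d - 1, Nat.sub_one_lt (NeZero.ne d)⟩

theorem height_pos (x : HyperbolicSpace d ϰ) : 0 < x.height := x.height_pos'

/-- The Riemannian distance of the metric `ϰ⁻¹ (dx₁² + ⋯ + dx_d²) / x_d²`. -/
instance : Dist (HyperbolicSpace d ϰ) where
  dist x y := 1 / √ϰ * Real.arcosh (1 + ‖x.point - y.point‖ ^ 2 / (2 * x.height * y.height))

/-- The distance for `ϰ = 1`. -/
def unitDist (x y : HyperbolicSpace d ϰ) : ℝ :=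
  Real.arcosh (1 + ‖x.point - y.point‖ ^ 2 / (2 * x.height * y.height))

theorem dist_def (x y : HyperbolicSpace d ϰ) : dist x y = 1 / √ϰ * unitDist x y := rfl

theorem one_le_arg (x y : HyperbolicSpace d ϰ) :
    1 ≤ 1 + ‖x.point - y.point‖ ^ 2 / (2 * x.height * y.height) := by
  have := x.height_pos
  have := y.height_pos
  have : 0 ≤ ‖x.point - y.point‖ ^ 2 / (2 * x.height * y.height) := by positivity
  linarith

theorem unitDist_nonneg (x y : HyperbolicSpace d ϰ) : 0 ≤ unitDist x y :=
  Real.arcosh_nonneg (one_le_arg x y)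

theorem sinh_half_unitDist (x y : HyperbolicSpace d ϰ) :
    Real.sinh (unitDist x y / 2) = ‖x.point - y.point‖ / (2 * √(x.height * y.height)) := by
  have hx := x.height_pos
  have hy := y.height_pos
  have h1 : Real.cosh (unitDist x y) =
      1 + ‖x.point - y.point‖ ^ 2 / (2 * x.height * y.height) :=
    Real.cosh_arcosh (one_le_arg x y)
  have h2 : Real.cosh (unitDist x y) = 1 + 2 * Real.sinh (unitDist x y / 2) ^ 2 := by
    have h3 := Real.cosh_two_mul (unitDist x y / 2)
    rw [mul_div_cancel₀ _ (two_ne_zero)] at h3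
    rw [h3, Real.cosh_sq]; ring
  have h4 : 0 ≤ Real.sinh (unitDist x y / 2) :=
    Real.sinh_nonneg_iff.2 (by have := unitDist_nonneg x y; linarith)
  rw [← pow_left_inj₀ h4 (by positivity) two_ne_zero, div_pow, mul_pow,
    Real.sq_sqrt (by positivity)]
  have h5 : 2 * Real.sinh (unitDist x y / 2) ^ 2 =
      ‖x.point - y.point‖ ^ 2 / (2 * x.height * y.height) := by linarith
  have h6 : Real.sinh (unitDist x y / 2) ^ 2 =
      (‖x.point - y.point‖ ^ 2 / (2 * x.height * y.height)) / 2 := by linarith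
  rw [h6]; field_simp

/-- The Euclidean reflection of a point at the boundary hyperplane. -/
def reflected (y : HyperbolicSpace d ϰ) : EuclideanSpace ℝ (Fin d) :=
  y.point - EuclideanSpace.single ⟨d - 1, Nat.sub_one_lt (NeZero.ne d)⟩ (2 * y.height)

theorem norm_sub_reflected_sq (x y : HyperbolicSpace d ϰ) :
    ‖x.point - y.reflected‖ ^ 2 = ‖x.point - y.point‖ ^ 2 + 4 * x.height * y.height := by
  have h : x.point - y.reflected = (x.point - y.point) +
      EuclideanSpace.single ⟨d - 1, Nat.sub_one_lt (NeZero.ne d)⟩ (2 * y.height) := by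
    rw [reflected]; abel
  rw [h, norm_add_sq_real, EuclideanSpace.inner_single_right]
  simp only [PiLp.norm_single, Real.norm_eq_abs, sq_abs, PiLp.sub_apply, conj_trivial]
  change _ + 2 * (2 * y.height * (x.height - y.height)) + _ = _
  ring

theorem cosh_half_unitDist (x y : HyperbolicSpace d ϰ) :
    Real.cosh (unitDist x y / 2) = ‖x.point - y.reflected‖ / (2 * √(x.height * y.height)) := by
  have hx := x.height_pos
  have hy := y.height_pos
  rw [← pow_left_inj₀ (Real.cosh_pos _).le (by positivity) two_ne_zero, Real.cosh_sq,
    sinh_half_unitDist, div_pow, div_pow, mul_pow, Real.sq_sqrt (by positivity),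
    norm_sub_reflected_sq]
  field_simp
  ring

theorem unitDist_triangle (x y z : HyperbolicSpace d ϰ) :
    unitDist x z ≤ unitDist x y + unitDist y z := by
  have hx := x.height_pos
  have hy := y.height_pos
  have hz := z.height_pos
  suffices h : unitDist x z / 2 ≤ unitDist x y / 2 + unitDist y z / 2 by linarith
  rw [← Real.sinh_le_sinh, Real.sinh_add, sinh_half_unitDist, sinh_half_unitDist,
    sinh_half_unitDist, cosh_half_unitDist, cosh_half_unitDist]
  have hpt := EuclideanGeometry.mul_dist_le_mul_dist_add_mul_dist
    x.point y.point z.point y.reflected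
  have hyy : dist y.point y.reflected = 2 * y.height := by
    rw [dist_eq_norm, ← pow_left_inj₀ (norm_nonneg _) (by positivity) two_ne_zero,
      norm_sub_reflected_sq]
    simp; ring
  have hzy : dist z.point y.reflected = ‖y.point - z.reflected‖ := by
    rw [dist_eq_norm, ← pow_left_inj₀ (norm_nonneg _) (norm_nonneg _) two_ne_zero,
      norm_sub_reflected_sq, norm_sub_reflected_sq, norm_sub_rev]
    ring
  rw [hyy, hzy, dist_eq_norm, dist_eq_norm, dist_eq_norm, dist_eq_norm] at hpt
  rw [Real.sqrt_mul hx.le, Real.sqrt_mul hx.le, Real.sqrt_mul hy.le]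
  have sx := Real.sqrt_pos.2 hx
  have sy := Real.sqrt_pos.2 hy
  have sz := Real.sqrt_pos.2 hz
  have e : ‖x.point - y.point‖ / (2 * (√x.height * √y.height)) *
        (‖y.point - z.reflected‖ / (2 * (√y.height * √z.height))) +
      ‖x.point - y.reflected‖ / (2 * (√x.height * √y.height)) *
        (‖y.point - z.point‖ / (2 * (√y.height * √z.height))) =
      (‖x.point - y.point‖ * ‖y.point - z.reflected‖ +
        ‖y.point - z.point‖ * ‖x.point - y.reflected‖) /
        (4 * y.height * (√x.height * √z.height)) := by
    have hs : 4 * y.height = 4 * (√y.height * √y.height) := by rw [Real.mul_self_sqrt hy.le]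
    rw [hs]
    field_simp
    ring
  rw [e, div_le_div_iff₀ (by positivity) (by positivity)]
  have := mul_le_mul_of_nonneg_right hpt (by positivity : 0 ≤ 2 * (√x.height * √z.height))
  linarith

instance [Fact (0 < ϰ)] : MetricSpace (HyperbolicSpace d ϰ) where
  dist_self x := by
    rw [dist_def, unitDist]; simp
  dist_comm x y := by
    rw [dist_def, dist_def, unitDist, unitDist, norm_sub_rev, mul_right_comm]
  dist_triangle x y z := by
    rw [dist_def, dist_def, dist_def, ← mul_add]
    exact mul_le_mul_of_nonneg_left (unitDist_triangle x y z) (by positivity)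
  eq_of_dist_eq_zero {x y} h := by
    have hϰ : 0 < ϰ := Fact.out
    have hx := x.height_pos
    have hy := y.height_pos
    rw [dist_def, mul_eq_zero] at h
    have h0 : unitDist x y = 0 := h.resolve_left (by positivity)
    have h1 := sinh_half_unitDist x y
    rw [h0, zero_div, Real.sinh_zero, eq_comm, div_eq_zero_iff] at h1
    exact HyperbolicSpace.ext (sub_eq_zero.1 (norm_eq_zero.1 (h1.resolve_right (by positivity))))

instance [Fact (0 < ϰ)] : MeasurableSpace (HyperbolicSpace d ϰ) := borel _

instance [Fact (0 < ϰ)] : BorelSpace (HyperbolicSpace d ϰ) := ⟨rfl⟩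

end HyperbolicSpace

/-- The `d`-dimensional Hausdorff measure of `ℍ^d(ϰ)` for the hyperbolic metric, with the usual
normalisation (the one for which it is Lebesgue measure on Euclidean `ℝ^d`). -/
def hyperbolicVolume (d : ℕ) [NeZero d] (ϰ : ℝ) [Fact (0 < ϰ)] : Measure (HyperbolicSpace d ϰ) :=
  Measure.euclideanHausdorffMeasure d

/-! ### Poisson processes -/

/-- The Poisson distribution on `ℕ ∪ {∞}` with mean `m ∈ [0, ∞]`; for `m = ∞` it is concentrated
in `∞`. -/
def poissonLaw (m : ℝ≥0∞) : Measure ℕ∞ :=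
  if m = ∞ then Measure.dirac ⊤ else (poissonMeasure m.toNNReal).map (fun n : ℕ => (n : ℕ∞))

/-- `η` is a Poisson process with intensity measure `μ` on the metric space `X`: a random locally
finite set such that the number of points in a Borel set `B` is a Poisson random variable with mean
`μ B`, and the numbers of points in disjoint Borel sets are independent. -/
structure IsPoissonProcess {Ω X : Type*} [MeasurableSpace Ω] [MetricSpace X] [MeasurableSpace X]
    (η : Ω → Set X) (μ : Measure X) (P : Measure Ω) : Prop where
  locallyFinite : ∀ ω, ∀ B : Set X, Bornology.IsBounded B → (η ω ∩ B).Finite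
  measurable_count : ∀ B : Set X, MeasurableSet B → Measurable fun ω => (η ω ∩ B).encard
  law_count : ∀ B : Set X, MeasurableSet B → P.map (fun ω => (η ω ∩ B).encard) = poissonLaw (μ B)
  indep_count : ∀ (k : ℕ) (B : Fin k → Set X), (∀ i, MeasurableSet (B i)) →
    Pairwise (Function.onFun Disjoint B) → iIndepFun (fun i ω => (η ω ∩ B i).encard) P

/-! ### The radial spanning tree -/

section RadialSpanningTree

variable {X : Type*} [MetricSpace X]

/-- `y` is a radial nearest neighbour of `x`: among the vertices (the points of `ξ ∪ {o}`) that are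
strictly closer to `o` than `x` is, `y` has minimal distance to `x`. -/
def IsRadialNearestNeighbour (o : X) (ξ : Set X) (x y : X) : Prop :=
  y ∈ insert o ξ ∧ dist o y < dist o x ∧
    ∀ z ∈ insert o ξ, dist o z < dist o x → dist x y ≤ dist x z

/-- The radial spanning tree on `ξ` with base point `o`: the graph with vertex set `ξ ∪ {o}` in
which every vertex other than `o` is joined to its radial nearest neighbour. (The vertex `o` has no
radial nearest neighbour, since no point is closer to `o` than `o` itself.) -/
def radialSpanningTree (o : X) (ξ : Set X) : SimpleGraph ↥(insert o ξ) where
  Adj x y := IsRadialNearestNeighbour o ξ x y ∨ IsRadialNearestNeighbour o ξ y x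
  symm := ⟨fun _ _ h => h.symm⟩
  loopless := ⟨fun _ h => h.elim (fun h => lt_irrefl _ h.2.1) (fun h => lt_irrefl _ h.2.1)⟩

/-- The degree of the origin in the radial spanning tree on `ξ`, possibly infinite. -/
def originDegree (o : X) (ξ : Set X) : ℕ∞ :=
  ((radialSpanningTree o ξ).neighborSet ⟨o, Set.mem_insert o ξ⟩).encard

end RadialSpanningTree

/-! ### Constants -/

/-- `ω_k = 2 π^{k/2} / Γ(k/2)`, the surface content of the unit sphere of `ℝ^k`. -/
def unitSphereArea (k : ℕ) : ℝ := 2 * Real.pi ^ ((k : ℝ) / 2) / Real.Gamma ((k : ℝ) / 2)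

/-- `κ_k = ω_k / k`, the volume of the unit ball of `ℝ^k`. -/
def unitBallVolume (k : ℕ) : ℝ := unitSphereArea k / k

/-- The integrand (as a function of `r`) of the formula for the expected degree of the origin. -/
def expectedDegreeIntegrand (d : ℕ) (ϰ γ r : ℝ) : ℝ :=
  Real.sinh r ^ (d - 1) *
    Real.exp (-(2 * γ * unitBallVolume (d - 1) * ϰ ^ (-(d : ℝ) / 2) *
      ∫ t in (0 : ℝ)..(r / 2),
        (Real.cosh r ^ 2 / Real.cosh (r - t) ^ 2 - 1) ^ (((d : ℝ) - 1) / 2)))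

end

/-! ### The Poisson law on `ℕ∞` -/

/-! A vertex x hangs on o exactly when the lens cut out by the two balls of radius dist(o, x) about
o and x contains no point of η. By a Mecke-type formula the expected degree is the integral over x
of the void probability exp(-γ vol(lens)) against the intensity measure
(`IsPoissonProcess.lintegral_originDegree`). The formula is derived from the laws of counts alone.
Space is cut into small cells, the lens of x is replaced by a slightly smaller one that depends only
on the cell of x and misses that cell, so count and void event are independent; then the cells
shrink.

The lens volume depends only on the distance of o and x and is found by slicing orthogonally to the
geodesic through them (`hyperbolicVolume_radialLens`). For this the Hausdorff measure is identified
with the half-space density, since the metric is locally almost a multiple of the Euclidean one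
(`hyperbolicVolume_eq_densityVolume`). It is then carried to hyperboloid coordinates, where balls
are given by Minkowski products. Polar coordinates finish (b).

For (a), the lens volume grows at least quadratically in the distance, so void probabilities beat
every exponential, while ball volumes grow only exponentially. All children lie inside the outermost
shell that contains one; this bounds the moments by a convergent sum
(`IsPoissonProcess.lintegral_originDegree_pow_lt_top`).

For (c), points far out in different directions are roughly twice as far from each other as from o.
With positive probability η has points near n such positions and nowhere else in a large ball, and
then o has at least n children (`natCast_le_originDegree`). -/

theorem lintegral_poissonLaw {m : ℝ≥0∞} (hm : m ≠ ∞) (f : ℕ∞ → ℝ≥0∞) :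
    ∫⁻ x, f x ∂poissonLaw m =
      ∑' n : ℕ, ENNReal.ofReal (Real.exp (-m.toReal) * m.toReal ^ n / n.factorial) * f n := by
  rw [poissonLaw, if_neg hm, lintegral_map .of_discrete .of_discrete, poissonMeasure,
    lintegral_sum_measure]
  refine tsum_congr fun n => ?_
  rw [lintegral_smul_measure, lintegral_dirac]
  rfl

instance isProbabilityMeasure_poissonLaw (m : ℝ≥0∞) : IsProbabilityMeasure (poissonLaw m) := by
  rw [poissonLaw]
  split_ifs
  · infer_instance
  · exact Measure.isProbabilityMeasure_map .of_discrete

/-- The size-biasing identity of the Poisson law. -/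
theorem lintegral_poissonLaw_id_mul {m : ℝ≥0∞} (hm : m ≠ ∞) (f : ℕ∞ → ℝ≥0∞) :
    ∫⁻ x, (x : ℝ≥0∞) * f x ∂poissonLaw m = m * ∫⁻ x, f (x + 1) ∂poissonLaw m := by
  rw [lintegral_poissonLaw hm, lintegral_poissonLaw hm, tsum_eq_zero_add' ENNReal.summable,
    ← ENNReal.tsum_mul_left]
  simp only [Nat.cast_zero, ENat.toENNReal_zero, zero_mul, mul_zero, zero_add]
  refine tsum_congr fun n => ?_
  have h1 : (((n + 1 : ℕ) : ℕ∞) : ℝ≥0∞) = ENNReal.ofReal (n + 1 : ℝ) := by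
    rw [ENat.toENNReal_coe, ← ENNReal.ofReal_natCast]; push_cast; rfl
  have h2 : ENNReal.ofReal (Real.exp (-m.toReal) * m.toReal ^ (n + 1) / (n + 1).factorial) *
      ENNReal.ofReal (n + 1 : ℝ) =
      m * ENNReal.ofReal (Real.exp (-m.toReal) * m.toReal ^ n / n.factorial) := by
    nth_rw 3 [← ENNReal.ofReal_toReal hm]
    rw [← ENNReal.ofReal_mul (by positivity), ← ENNReal.ofReal_mul (by positivity)]
    congr 1
    rw [Nat.factorial_succ]
    push_cast
    field_simp
    try ring
  rw [h1, ← mul_assoc, h2, mul_assoc]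
  push_cast
  rfl

theorem lintegral_poissonLaw_id {m : ℝ≥0∞} (hm : m ≠ ∞) :
    ∫⁻ x, (x : ℝ≥0∞) ∂poissonLaw m = m := by
  simpa using lintegral_poissonLaw_id_mul hm fun _ => 1

theorem poissonLaw_singleton_zero {m : ℝ≥0∞} (hm : m ≠ ∞) :
    poissonLaw m {0} = ENNReal.ofReal (Real.exp (-m.toReal)) := by
  rw [← lintegral_indicator_one (measurableSet_singleton _), lintegral_poissonLaw hm,
    tsum_eq_single 0]
  · simp
  · intro n hn
    simp [hn]

theorem poissonLaw_singleton_zero_compl_pos {m : ℝ≥0∞} (hm : m ≠ 0) : 0 < poissonLaw m {0}ᶜ := by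
  by_cases h : m = ∞
  · simp [poissonLaw, h]
  rw [prob_compl_eq_one_sub (measurableSet_singleton _), poissonLaw_singleton_zero h, tsub_pos_iff_lt,
    ENNReal.ofReal_lt_one, Real.exp_lt_one_iff]
  simpa using ENNReal.toReal_pos hm h

/-- Size biasing gives E[N^(p+1)] = m E[(N+1)^p], which drives the induction on p. The constant must
not depend on m, because the bound is later used for balls of growing radius. -/
theorem exists_poissonLaw_moment_le (p : ℕ) :
    ∃ C : ℝ≥0∞, C ≠ ∞ ∧ ∀ m : ℝ≥0∞, m ≠ ∞ →
      ∫⁻ x, (x : ℝ≥0∞) ^ p ∂poissonLaw m ≤ C * (m + 1) ^ p := by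
  induction p with
  | zero => exact ⟨1, by simp, fun m _ => by simp⟩
  | succ p ih =>
    obtain ⟨C, hC, h⟩ := ih
    refine ⟨2 ^ p * (C + 1), by finiteness, fun m hm => ?_⟩
    have h1 : ∀ x : ℕ∞, ((x + 1 : ℕ∞) : ℝ≥0∞) ^ p ≤ 2 ^ p * ((x : ℝ≥0∞) ^ p + 1) := by
      intro x
      have : ((x + 1 : ℕ∞) : ℝ≥0∞) ≤ 2 * max (x : ℝ≥0∞) 1 := by
        push_cast
        rw [two_mul]
        gcongr <;> simp
      refine (pow_le_pow_left' this p).trans ?_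
      rw [mul_pow]
      gcongr
      rcases le_total (x : ℝ≥0∞) 1 with hx | hx
      · simp [max_eq_right hx]
      · simp [max_eq_left hx]
    calc ∫⁻ x, (x : ℝ≥0∞) ^ (p + 1) ∂poissonLaw m
        = m * ∫⁻ x, ((x + 1 : ℕ∞) : ℝ≥0∞) ^ p ∂poissonLaw m := by
          rw [← lintegral_poissonLaw_id_mul hm fun x => (x : ℝ≥0∞) ^ p]
          simp_rw [pow_succ']
      _ ≤ m * (2 ^ p * (C * (m + 1) ^ p + 1)) := by
          gcongr
          refine (lintegral_mono h1).trans ?_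
          rw [lintegral_const_mul _ (.of_discrete), lintegral_add_right _ (.of_discrete)]
          gcongr
          · exact h m hm
          · simp
      _ ≤ (m + 1) * (2 ^ p * (C * (m + 1) ^ p + (m + 1) ^ p)) := by
          gcongr
          · exact le_self_add
          · exact one_le_pow₀ le_add_self
      _ = _ := by ring

/-! ### Children of the origin -/

section Children

variable {X : Type*} [MetricSpace X]

/-- The intersection of the balls around `o` and around `x` whose radius is the distance of
`o` and `x`. -/
def radialLens (o x : X) : Set X := Metric.ball o (dist o x) ∩ Metric.ball x (dist o x)

/-- The points of `ξ` whose radial nearest neighbour is the origin. -/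
def originChildren (o : X) (ξ : Set X) : Set X :=
  {x | x ∈ ξ ∧ x ≠ o ∧ ξ ∩ radialLens o x = ∅}

theorem mem_radialLens {o x z : X} :
    z ∈ radialLens o x ↔ dist o z < dist o x ∧ dist x z < dist o x := by
  rw [radialLens, Set.mem_inter_iff, Metric.mem_ball', Metric.mem_ball']

theorem isBounded_radialLens (o x : X) : Bornology.IsBounded (radialLens o x) :=
  Metric.isBounded_ball.subset Set.inter_subset_left

theorem isOpen_radialLens (o x : X) : IsOpen (radialLens o x) :=
  Metric.isOpen_ball.inter Metric.isOpen_ball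

theorem isRadialNearestNeighbour_origin_iff {o : X} {ξ : Set X} {x : X} :
    IsRadialNearestNeighbour o ξ x o ↔ x ≠ o ∧ ξ ∩ radialLens o x = ∅ := by
  simp only [IsRadialNearestNeighbour, Set.mem_insert_iff, true_or, true_and, dist_self,
    dist_pos, Set.eq_empty_iff_forall_notMem, Set.mem_inter_iff, mem_radialLens, not_and, not_lt,
    forall_eq_or_imp, le_refl, implies_true]
  rw [ne_comm, dist_comm x o]

theorem originDegree_eq_encard (o : X) (ξ : Set X) :
    originDegree o ξ = (originChildren o ξ).encard := by
  rw [originDegree, ← Subtype.val_injective.encard_image]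
  congr 1
  ext x
  simp only [Set.mem_image, SimpleGraph.mem_neighborSet, radialSpanningTree, Subtype.exists,
    exists_and_right, exists_eq_right, originChildren, Set.mem_ofPred_eq,
    isRadialNearestNeighbour_origin_iff]
  constructor
  · rintro ⟨hx, h | h⟩
    · exact absurd h.2.1 (by simp)
    · exact ⟨hx.resolve_left h.1, h⟩
  · rintro ⟨hx, h⟩
    exact ⟨Or.inr hx, Or.inr h⟩

/-- A lens that is contained in `radialLens o x` for all `x` within distance `ε` of `u`. -/
def innerLens (o u : X) (ε : ℝ) : Set X :=
  Metric.ball o (dist o u - ε) ∩ Metric.ball u (dist o u - 2 * ε)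

theorem isOpen_innerLens (o u : X) (ε : ℝ) : IsOpen (innerLens o u ε) :=
  Metric.isOpen_ball.inter Metric.isOpen_ball

/-- In the ball about the second centre one ε pays for moving that centre from u to x and one for
replacing the radius dist o u by dist o x. -/
theorem innerLens_subset_radialLens {o u x : X} {ε : ℝ} (h : dist x u < ε) :
    innerLens o u ε ⊆ radialLens o x := by
  intro z hz
  rw [innerLens, Set.mem_inter_iff, Metric.mem_ball', Metric.mem_ball'] at hz
  rw [mem_radialLens]
  have h1 := dist_triangle o x u
  have h2 := dist_triangle x u z
  constructor <;> linarith [hz.1, hz.2]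

/-- This makes a cell disjoint from its inner lens, which is what independence of the two counts
requires. -/
theorem notMem_innerLens {o u x : X} {ε : ℝ} (h : dist x u < ε) : x ∉ innerLens o u ε := by
  intro hz
  rw [innerLens, Set.mem_inter_iff, Metric.mem_ball'] at hz
  have h1 := dist_triangle o x u
  linarith [hz.1]

/-- Membership in the lens is given by strict inequalities, so each of its points has slack that
eventually exceeds the loss of order ε. -/
theorem eventually_mem_innerLens {o x z : X} {u : ℕ → X} {ε : ℕ → ℝ}
    (hε : Filter.Tendsto ε Filter.atTop (nhds 0)) (hu : ∀ n, dist x (u n) < ε n)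
    (hz : z ∈ radialLens o x) : ∀ᶠ n in Filter.atTop, z ∈ innerLens o (u n) (ε n) := by
  rw [mem_radialLens] at hz
  have h1 : ∀ᶠ n in Filter.atTop, ε n < (dist o x - dist o z) / 2 :=
    hε.eventually_lt_const (by linarith [hz.1])
  have h2 : ∀ᶠ n in Filter.atTop, ε n < (dist o x - dist x z) / 4 :=
    hε.eventually_lt_const (by linarith [hz.2])
  filter_upwards [h1, h2] with n h1 h2
  have h3 := dist_triangle o (u n) x
  have h4 := dist_triangle (u n) x z
  have h5 := hu n
  rw [dist_comm (u n) x] at h3 h4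
  rw [innerLens, Set.mem_inter_iff, Metric.mem_ball', Metric.mem_ball']
  constructor <;> linarith

end Children

/-! ### Countable measurable partitions of small mesh -/

section Cells

variable {X : Type*} [MetricSpace X] [TopologicalSpace.SeparableSpace X] [Nonempty X]

theorem exists_dist_denseSeq_lt (n : ℕ) (x : X) :
    ∃ i, dist x (TopologicalSpace.denseSeq X i) < 1 / ((n : ℝ) + 1) := by
  exact (TopologicalSpace.denseRange_denseSeq X).exists_dist_lt x (by positivity)

open Classical in
/-- The index of the first point of the dense sequence within distance `1 / (n + 1)` of `x`. -/
noncomputable def cellIndex (n : ℕ) (x : X) : ℕ := Nat.find (exists_dist_denseSeq_lt n x)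

theorem dist_denseSeq_cellIndex_lt (n : ℕ) (x : X) :
    dist x (TopologicalSpace.denseSeq X (cellIndex n x)) < 1 / ((n : ℝ) + 1) := by
  classical
  exact Nat.find_spec (exists_dist_denseSeq_lt n x)

theorem measurable_cellIndex [MeasurableSpace X] [OpensMeasurableSpace X] (n : ℕ) :
    Measurable (cellIndex n : X → ℕ) := by
  classical
  exact measurable_find _ fun i =>
    (isOpen_lt (continuous_id.dist continuous_const) continuous_const).measurableSet

end Cells

/-- Passes between the sum over cells, suited to independence, and the sum over points, suited to
the limit of shrinking cells. -/
theorem tsum_encard_inter_mul {X : Type*} {S : Set X} (hS : S.Finite) (idx : X → ℕ)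
    (a : ℕ → ℝ≥0∞) :
    ∑' i, ((S ∩ idx ⁻¹' {i}).encard : ℝ≥0∞) * a i = ∑ x ∈ hS.toFinset, a (idx x) := by
  classical
  have h : ∀ i, ((S ∩ idx ⁻¹' {i}).encard : ℝ≥0∞) * a i =
      ∑ x ∈ hS.toFinset, if i = idx x then a i else 0 := by
    intro i
    have h1 : S ∩ idx ⁻¹' {i} = (hS.toFinset.filter fun x => i = idx x : Finset X) := by
      ext x; simp [eq_comm]
    rw [h1, Set.encard_coe_eq_coe_finsetCard, ← Finset.sum_filter, Finset.sum_const, nsmul_eq_mul]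
    simp
  simp_rw [h]
  rw [Summable.tsum_finsetSum fun _ _ => ENNReal.summable]
  simp

theorem encard_inter_originChildren {X : Type*} [MetricSpace X] {o : X} {ξ A : Set X}
    (hS : (ξ ∩ A).Finite) (hA : o ∉ A) [DecidablePred fun x => ξ ∩ radialLens o x = ∅] :
    ((originChildren o ξ ∩ A).encard : ℝ≥0∞) =
      ∑ x ∈ hS.toFinset, if ξ ∩ radialLens o x = ∅ then 1 else 0 := by
  classical
  have h1 : originChildren o ξ ∩ A =
      (hS.toFinset.filter fun x => ξ ∩ radialLens o x = ∅ : Finset X) := by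
    ext x
    simp only [originChildren, Set.mem_inter_iff, Set.mem_ofPred_eq, Finset.coe_filter,
      Set.Finite.mem_toFinset]
    constructor
    · tauto
    · rintro ⟨⟨h1, h2⟩, h3⟩
      exact ⟨⟨h1, fun h => hA (h ▸ h2), h3⟩, h2⟩
  rw [h1, Set.encard_coe_eq_coe_finsetCard]
  simp

/-! ### Mecke's formula for functionals constant on cells -/

section Campbell

variable {Ω X : Type*} [MeasurableSpace Ω] [MetricSpace X] [MeasurableSpace X]
  {η : Ω → Set X} {μ : Measure X} {P : Measure Ω}

theorem IsPoissonProcess.measurable_toENNReal_count (hη : IsPoissonProcess η μ P) {B : Set X}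
    (hB : MeasurableSet B) : Measurable fun ω => ((η ω ∩ B).encard : ℝ≥0∞) :=
  (Measurable.of_discrete (f := fun n : ℕ∞ => (n : ℝ≥0∞))).comp (hη.measurable_count B hB)

theorem IsPoissonProcess.lintegral_count (hη : IsPoissonProcess η μ P) {B : Set X}
    (hB : MeasurableSet B) (f : ℕ∞ → ℝ≥0∞) :
    ∫⁻ ω, f (η ω ∩ B).encard ∂P = ∫⁻ n, f n ∂poissonLaw (μ B) := by
  rw [← hη.law_count B hB, lintegral_map .of_discrete (hη.measurable_count B hB)]

theorem IsPoissonProcess.measurableSet_inter_eq_empty (hη : IsPoissonProcess η μ P) {B : Set X}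
    (hB : MeasurableSet B) : MeasurableSet {ω | η ω ∩ B = ∅} := by
  have : {ω | η ω ∩ B = ∅} = (fun ω => (η ω ∩ B).encard) ⁻¹' {0} := by
    ext ω; simp
  rw [this]
  exact hη.measurable_count B hB (measurableSet_singleton _)

open Classical in
theorem IsPoissonProcess.lintegral_encard_mul_void (hη : IsPoissonProcess η μ P) {A B : Set X}
    (hA : MeasurableSet A) (hB : MeasurableSet B) (hAB : Disjoint A B) (hμ : μ A ≠ ∞) :
    ∫⁻ ω, ((η ω ∩ A).encard : ℝ≥0∞) * (if η ω ∩ B = ∅ then 1 else 0) ∂P =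
      μ A * poissonLaw (μ B) {0} := by
  have hind := (hη.indep_count 2 ![A, B] (by intro i; fin_cases i <;> assumption)
    (by
      intro i j hij
      fin_cases i <;> fin_cases j <;> simp_all [Function.onFun, disjoint_comm])).indepFun
    (show (0 : Fin 2) ≠ 1 by simp)
  simp only [Matrix.cons_val_zero, Matrix.cons_val_one] at hind
  have h2 : ∀ ω, (if η ω ∩ B = ∅ then (1 : ℝ≥0∞) else 0) =
      Set.indicator {0} 1 (η ω ∩ B).encard := by
    intro ω
    simp [Set.indicator_apply]
  simp_rw [h2]
  rw [lintegral_mul_eq_lintegral_mul_lintegral_of_indepFun''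
    (f := fun ω => ((η ω ∩ A).encard : ℝ≥0∞))
    (g := fun ω => Set.indicator {0} 1 (η ω ∩ B).encard)]
  · rw [hη.lintegral_count hA, hη.lintegral_count hB, lintegral_poissonLaw_id hμ,
      lintegral_indicator_one (measurableSet_singleton _)]
  · exact (hη.measurable_toENNReal_count hA).aemeasurable
  · exact ((Measurable.of_discrete (f := Set.indicator ({0} : Set ℕ∞) (1 : ℕ∞ → ℝ≥0∞))).comp
      (hη.measurable_count B hB)).aemeasurable
  · exact hind.comp (φ := fun n : ℕ∞ => (n : ℝ≥0∞)) (ψ := Set.indicator {0} 1)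
      .of_discrete .of_discrete

open Classical in
-- A discrete Mecke formula: the region that must be void depends on x only through its cell and
-- avoids that cell, so each summand factorises by independence.
theorem IsPoissonProcess.lintegral_tsum_encard_mul_void (hη : IsPoissonProcess η μ P)
    {A : Set X} (hA : MeasurableSet A) (hμ : μ A ≠ ∞) {idx : X → ℕ} (hidx : Measurable idx)
    {U : ℕ → Set X} (hU : ∀ i, MeasurableSet (U i)) (hdisj : ∀ x, x ∉ U (idx x)) :
    ∫⁻ ω, ∑' i, ((η ω ∩ A ∩ idx ⁻¹' {i}).encard : ℝ≥0∞) *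
        (if η ω ∩ U i = ∅ then 1 else 0) ∂P =
      ∫⁻ x in A, poissonLaw (μ (U (idx x))) {0} ∂μ := by
  have hcell : ∀ i, MeasurableSet (A ∩ idx ⁻¹' {i}) := fun i =>
    hA.inter (hidx (measurableSet_singleton i))
  have hd : ∀ i, Disjoint (A ∩ idx ⁻¹' {i}) (U i) := by
    intro i
    rw [Set.disjoint_left]
    rintro x ⟨-, rfl⟩
    exact hdisj x
  simp_rw [Set.inter_assoc]
  have hmeas : ∀ i, Measurable fun ω => ((η ω ∩ (A ∩ idx ⁻¹' {i})).encard : ℝ≥0∞) *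
      (if η ω ∩ U i = ∅ then 1 else 0) := fun i =>
    (hη.measurable_toENNReal_count (hcell i)).mul (Measurable.ite
      (hη.measurableSet_inter_eq_empty (hU i)) measurable_const measurable_const)
  rw [lintegral_tsum fun i => (hmeas i).aemeasurable]
  rw [← lintegral_map (μ := μ.restrict A) (f := fun i => poissonLaw (μ (U i)) {0})
    .of_discrete hidx, lintegral_countable']
  refine tsum_congr fun i => ?_
  rw [hη.lintegral_encard_mul_void (hcell i) (hU i) (hd i)
    (measure_ne_top_of_subset Set.inter_subset_left hμ),
    Measure.map_apply hidx (measurableSet_singleton i),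
    Measure.restrict_apply (hidx (measurableSet_singleton i)), mul_comm, Set.inter_comm]

end Campbell

/-! ### Mecke's formula for children of the origin, by refining the cells -/

section Campbell

open Filter Topology

variable {X : Type*} [MetricSpace X]

open Classical in
/-- The number of points `x` of `ξ` in `A` for which the inner lens of the cell of `x` is void. -/
noncomputable def approxChildren [TopologicalSpace.SeparableSpace X] [Nonempty X] (o : X)
    (A : Set X) (n : ℕ) (ξ : Set X) : ℝ≥0∞ :=
  ∑' i, ((ξ ∩ A ∩ cellIndex n ⁻¹' {i}).encard : ℝ≥0∞) *
    (if ξ ∩ innerLens o (TopologicalSpace.denseSeq X i) (1 / ((n : ℝ) + 1)) = ∅ then 1 else 0)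

open Classical in
-- By local finiteness only finitely many points lie in `A` and finitely many in the lens of each.
-- Once the inner lens of x has swallowed the latter, it is void exactly when the full lens is.
theorem tendsto_approxChildren [TopologicalSpace.SeparableSpace X] [Nonempty X] {o : X}
    {A ξ : Set X} (hξ : ∀ B : Set X, Bornology.IsBounded B → (ξ ∩ B).Finite)
    (hA : Bornology.IsBounded A) (hoA : o ∉ A) :
    Tendsto (fun n => approxChildren o A n ξ) atTop (𝓝 ((originChildren o ξ ∩ A).encard : ℝ≥0∞)) := by
  have hS := hξ A hA
  simp only [approxChildren]
  simp_rw [tsum_encard_inter_mul hS]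
  rw [encard_inter_originChildren hS hoA]
  refine tendsto_finsetSum _ fun x _ => ?_
  refine Tendsto.congr' ?_ tendsto_const_nhds
  have hε : Tendsto (fun n : ℕ => 1 / ((n : ℝ) + 1)) atTop (𝓝 0) :=
    tendsto_one_div_add_atTop_nhds_zero_nat
  have hL := hξ _ (isBounded_radialLens o x)
  have hev : ∀ᶠ n : ℕ in atTop, ∀ z ∈ ξ ∩ radialLens o x,
      z ∈ innerLens o (TopologicalSpace.denseSeq X (cellIndex n x)) (1 / ((n : ℝ) + 1)) := by
    rw [hL.eventually_all]
    intro z hz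
    exact eventually_mem_innerLens hε (fun n => dist_denseSeq_cellIndex_lt n x) hz.2
  filter_upwards [hev] with n hn
  congr 1
  rw [eq_iff_iff]
  constructor
  · intro h
    exact Set.subset_eq_empty (Set.inter_subset_inter_right _
      (innerLens_subset_radialLens (dist_denseSeq_cellIndex_lt n x))) h
  · intro h
    rw [Set.eq_empty_iff_forall_notMem] at h ⊢
    exact fun z hz => h z ⟨hz.1, hn z hz⟩

theorem approxChildren_le [TopologicalSpace.SeparableSpace X] [Nonempty X] (o : X)
    {A ξ : Set X} (hS : (ξ ∩ A).Finite) (n : ℕ) :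
    approxChildren o A n ξ ≤ (ξ ∩ A).encard := by
  classical
  rw [approxChildren, tsum_encard_inter_mul hS]
  calc _ ≤ ∑ x ∈ hS.toFinset, (1 : ℝ≥0∞) := Finset.sum_le_sum fun x _ => by split_ifs <;> simp
    _ = _ := by simp [hS.encard_eq_coe_toFinset_card]

variable {Ω : Type*} [MeasurableSpace Ω] [MeasurableSpace X] [BorelSpace X]
  {η : Ω → Set X} {μ : Measure X} {P : Measure Ω}

theorem IsPoissonProcess.measurable_approxChildren [TopologicalSpace.SeparableSpace X] [Nonempty X]
    (hη : IsPoissonProcess η μ P) (o : X) {A : Set X} (hA : MeasurableSet A) (n : ℕ) :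
    Measurable fun ω => approxChildren o A n (η ω) := by
  classical
  refine Measurable.tsum fun i => ?_
  simp_rw [Set.inter_assoc]
  exact (hη.measurable_toENNReal_count
    (hA.inter (measurable_cellIndex n (measurableSet_singleton i)))).mul (Measurable.ite
    (hη.measurableSet_inter_eq_empty (isOpen_innerLens _ _ _).measurableSet)
      measurable_const measurable_const)

/-- The set of children is not a count in a fixed Borel set, so measurability comes from the
approximations, which are built from such counts. -/
theorem IsPoissonProcess.measurable_encard_children_inter [TopologicalSpace.SeparableSpace X]
    (hη : IsPoissonProcess η μ P) {o : X} {A : Set X} (hA : MeasurableSet A)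
    (hAb : Bornology.IsBounded A) (hoA : o ∉ A) :
    Measurable fun ω => ((originChildren o (η ω) ∩ A).encard : ℝ≥0∞) :=
  have : Nonempty X := ⟨o⟩
  measurable_of_tendsto_metrizable (hη.measurable_approxChildren o hA)
    (tendsto_pi_nhds.2 fun ω => tendsto_approxChildren (hη.locallyFinite ω) hAb hoA)

theorem tendsto_measure_innerLens [TopologicalSpace.SeparableSpace X] [Nonempty X] (o x : X)
    (hμ : ∀ B : Set X, Bornology.IsBounded B → μ B ≠ ∞) :
    Tendsto (fun n : ℕ => μ (innerLens o (TopologicalSpace.denseSeq X (cellIndex n x))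
      (1 / ((n : ℝ) + 1)))) atTop (𝓝 (μ (radialLens o x))) := by
  refine tendsto_measure_of_tendsto_indicator atTop
    (fun n => (isOpen_innerLens _ _ _).measurableSet) (isOpen_radialLens o x).measurableSet
    (hμ _ (isBounded_radialLens o x))
    (Eventually.of_forall fun n => innerLens_subset_radialLens (dist_denseSeq_cellIndex_lt n x)) ?_
  intro z
  by_cases hz : z ∈ radialLens o x
  · filter_upwards [eventually_mem_innerLens tendsto_one_div_add_atTop_nhds_zero_nat
      (fun n => dist_denseSeq_cellIndex_lt n x) hz] with n hn
    exact iff_of_true hn hz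
  · refine Eventually.of_forall fun n => iff_of_false (fun h => hz ?_) hz
    exact innerLens_subset_radialLens (dist_denseSeq_cellIndex_lt n x) h

theorem tendsto_poissonLaw_singleton_zero {ι : Type*} {l : Filter ι} {m : ι → ℝ≥0∞} {a : ℝ≥0∞}
    (ha : a ≠ ∞) (h : Tendsto m l (𝓝 a)) :
    Tendsto (fun i => poissonLaw (m i) {0}) l (𝓝 (poissonLaw a {0})) := by
  have h1 : ∀ᶠ i in l, m i ≠ ∞ := h.eventually_ne ha
  rw [poissonLaw_singleton_zero ha]
  refine Tendsto.congr' (h1.mono fun i hi => (poissonLaw_singleton_zero hi).symm) ?_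
  exact ENNReal.tendsto_ofReal ((Real.continuous_exp.tendsto _).comp
    ((ENNReal.tendsto_toReal ha).comp h).neg)

/-- Dominated convergence on both sides of the discrete formula: the number of points in `A`
dominates the left side, the constant 1 on `A` the right. -/
theorem IsPoissonProcess.lintegral_encard_children_inter [TopologicalSpace.SeparableSpace X]
    (hη : IsPoissonProcess η μ P) (hμ : ∀ B : Set X, Bornology.IsBounded B → μ B ≠ ∞) {o : X}
    {A : Set X} (hA : MeasurableSet A) (hAb : Bornology.IsBounded A) (hoA : o ∉ A) :
    ∫⁻ ω, ((originChildren o (η ω) ∩ A).encard : ℝ≥0∞) ∂P =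
      ∫⁻ x in A, poissonLaw (μ (radialLens o x)) {0} ∂μ := by
  have : Nonempty X := ⟨o⟩
  have h1 : Tendsto (fun n => ∫⁻ ω, approxChildren o A n (η ω) ∂P) atTop
      (𝓝 (∫⁻ ω, ((originChildren o (η ω) ∩ A).encard : ℝ≥0∞) ∂P)) := by
    refine tendsto_lintegral_of_dominated_convergence
      (fun ω => ((η ω ∩ A).encard : ℝ≥0∞)) (hη.measurable_approxChildren o hA)
      (fun n => ae_of_all _ fun ω => approxChildren_le o (hη.locallyFinite ω A hAb) n) ?_
      (ae_of_all _ fun ω => tendsto_approxChildren (hη.locallyFinite ω) hAb hoA)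
    rw [hη.lintegral_count hA fun n => (n : ℝ≥0∞), lintegral_poissonLaw_id (hμ A hAb)]
    exact hμ A hAb
  refine tendsto_nhds_unique h1 ?_
  have h2 : ∀ n : ℕ, ∫⁻ ω, approxChildren o A n (η ω) ∂P = ∫⁻ x in A, poissonLaw
      (μ (innerLens o (TopologicalSpace.denseSeq X (cellIndex n x)) (1 / ((n : ℝ) + 1)))) {0} ∂μ :=
    fun n => hη.lintegral_tsum_encard_mul_void hA (hμ A hAb) (measurable_cellIndex n)
      (fun i => (isOpen_innerLens o (TopologicalSpace.denseSeq X i) _).measurableSet)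
      (fun x => notMem_innerLens (dist_denseSeq_cellIndex_lt n x))
  simp_rw [h2]
  refine tendsto_lintegral_of_dominated_convergence (fun _ => 1) (fun n => ?_)
    (fun n => ae_of_all _ fun x => prob_le_one) ?_ (ae_of_all _ fun x => ?_)
  · exact (Measurable.of_discrete (f := fun i => poissonLaw (μ (innerLens o
      (TopologicalSpace.denseSeq X i) (1 / ((n : ℝ) + 1)))) {0})).comp (measurable_cellIndex n)
  · simpa using hμ A hAb
  · exact tendsto_poissonLaw_singleton_zero (hμ _ (isBounded_radialLens o x))
      (tendsto_measure_innerLens o x hμ)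

end Campbell

/-! ### Moments of the degree of the origin -/

theorem toENNReal_encard_iUnion {X : Type*} {s : ℕ → Set X}
    (hs : Pairwise (Function.onFun Disjoint s)) :
    ((⋃ i, s i).encard : ℝ≥0∞) = ∑' i, ((s i).encard : ℝ≥0∞) := by
  let _ : MeasurableSpace X := ⊤
  -- Cardinality is counting measure on the full σ-algebra, so σ-additivity gives the claim.
  have h : ∀ t : Set X, (t.encard : ℝ≥0∞) = Measure.count t := fun t =>
    (Measure.count_apply (MeasurableSpace.measurableSet_top)).symm
  simp_rw [h]
  exact measure_iUnion hs fun _ => MeasurableSpace.measurableSet_top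

section Shells

variable {X : Type*} [MetricSpace X]

/-- The points other than `o` whose distance to `o` lies in `[k, k + 1)`. -/
def radialShell (o : X) (k : ℕ) : Set X := {x | x ≠ o ∧ (k : ℝ) ≤ dist o x ∧ dist o x < k + 1}

theorem radialShell_subset_ball (o : X) (k : ℕ) : radialShell o k ⊆ Metric.ball o (k + 1) :=
  fun _ hx => Metric.mem_ball'.2 hx.2.2

theorem measurableSet_radialShell [MeasurableSpace X] [BorelSpace X] (o : X) (k : ℕ) :
    MeasurableSet (radialShell o k) :=
  (measurableSet_singleton o).compl.inter
    ((isClosed_le continuous_const (continuous_const.dist continuous_id)).measurableSet.inter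
      (isOpen_lt (continuous_const.dist continuous_id) continuous_const).measurableSet)

theorem isBounded_radialShell (o : X) (k : ℕ) : Bornology.IsBounded (radialShell o k) :=
  Metric.isBounded_ball.subset (radialShell_subset_ball o k)

theorem notMem_radialShell (o : X) (k : ℕ) : o ∉ radialShell o k := fun h => h.1 rfl

theorem floor_dist_of_mem_radialShell {o x : X} {k : ℕ} (h : x ∈ radialShell o k) :
    ⌊dist o x⌋₊ = k :=
  (Nat.floor_eq_iff dist_nonneg).2 h.2

theorem pairwise_disjoint_radialShell (o : X) :
    Pairwise (Function.onFun Disjoint (radialShell o)) := by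
  intro i j hij
  refine Set.disjoint_left.2 fun x hi hj => hij ?_
  rw [← floor_dist_of_mem_radialShell hi, floor_dist_of_mem_radialShell hj]

theorem iUnion_radialShell (o : X) : ⋃ k, radialShell o k = {o}ᶜ := by
  ext x
  simp only [Set.mem_iUnion, Set.mem_compl_iff, Set.mem_singleton_iff]
  constructor
  · rintro ⟨k, h⟩
    exact h.1
  · intro h
    exact ⟨⌊dist o x⌋₊, h, Nat.floor_le dist_nonneg, Nat.lt_floor_add_one _⟩

theorem originDegree_eq_tsum (o : X) (ξ : Set X) :
    (originDegree o ξ : ℝ≥0∞) = ∑' k, ((originChildren o ξ ∩ radialShell o k).encard : ℝ≥0∞) := by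
  rw [originDegree_eq_encard, ← toENNReal_encard_iUnion, ← Set.inter_iUnion, iUnion_radialShell,
    Set.inter_eq_left.2]
  · exact fun x hx => hx.2.1
  · exact fun i j hij => (pairwise_disjoint_radialShell o hij).mono Set.inter_subset_right
      Set.inter_subset_right

theorem sum_encard_children_le (o : X) (ξ : Set X) (K : ℕ) :
    ∑ k ∈ Finset.range (K + 1), ((originChildren o ξ ∩ radialShell o k).encard : ℝ≥0∞) ≤
      ((ξ ∩ Metric.ball o (K + 1)).encard : ℝ≥0∞) := by
  have h : ∑ k ∈ Finset.range (K + 1), ((originChildren o ξ ∩ radialShell o k).encard : ℝ≥0∞) ≤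
      ∑' k, ((ξ ∩ Metric.ball o (K + 1) ∩ radialShell o k).encard : ℝ≥0∞) := by
    refine (Finset.sum_le_sum fun k hk => ?_).trans (ENNReal.sum_le_tsum (Finset.range (K + 1)))
    refine ENat.toENNReal_mono (Set.encard_le_encard ?_)
    rintro x ⟨hx, hk'⟩
    refine ⟨⟨hx.1, Metric.ball_subset_ball ?_ (radialShell_subset_ball o k hk')⟩, hk'⟩
    have : k ≤ K := by simpa [Nat.lt_succ_iff] using hk
    gcongr
  refine h.trans ?_
  rw [← toENNReal_encard_iUnion]
  · gcongr
    exact Set.iUnion_subset fun k => Set.inter_subset_left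
  · exact fun i j hij => (pairwise_disjoint_radialShell o hij).mono Set.inter_subset_right
      Set.inter_subset_right

open Classical in
-- If the outermost shell with a child is the k-th, all children lie in the ball of radius k + 1, so
-- a single term of the right side already suffices. Working with partial sums avoids having to know
-- that such a shell exists.
theorem originDegree_pow_le (o : X) (ξ : Set X) {n : ℕ} (hn : n ≠ 0) :
    (originDegree o ξ : ℝ≥0∞) ^ n ≤ ∑' k : ℕ, ((ξ ∩ Metric.ball o (k + 1)).encard : ℝ≥0∞) ^ n *
      (if originChildren o ξ ∩ radialShell o k = ∅ then 0 else 1) := by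
  have key : ∀ K : ℕ, (∑ k ∈ Finset.range K,
        ((originChildren o ξ ∩ radialShell o k).encard : ℝ≥0∞)) ^ n ≤
      ∑ k ∈ Finset.range K, ((ξ ∩ Metric.ball o ((k : ℝ) + 1)).encard : ℝ≥0∞) ^ n *
        (if originChildren o ξ ∩ radialShell o k = ∅ then 0 else 1) := by
    intro K
    induction K with
    | zero => simp [hn]
    | succ K ih =>
      -- An empty shell changes neither side; a nonempty one makes its own term dominate everything
      -- so far.
      by_cases h : originChildren o ξ ∩ radialShell o K = ∅
      · rw [Finset.sum_range_succ, Finset.sum_range_succ]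
        simpa [h] using ih
      · refine le_trans ?_ (Finset.single_le_sum (fun _ _ => zero_le) (Finset.self_mem_range_succ K))
        rw [if_neg h, mul_one]
        exact pow_le_pow_left' (sum_encard_children_le o ξ K) n
  rw [originDegree_eq_tsum]
  refine le_of_tendsto (ENNReal.Tendsto.pow (ENNReal.tendsto_nat_tsum _))
    (Filter.Eventually.of_forall fun K => (key K).trans (ENNReal.sum_le_tsum _))

end Shells

/-- A weighted substitute for the Cauchy–Schwarz inequality: it decouples the ball count from the
event that a shell has a child, and `N`, the number of such children, has a known mean. Either a ≤
1/t or 1 ≤ ta. -/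
theorem ENNReal.mul_ite_le {a t : ℝ≥0∞} (ht0 : t ≠ 0) (ht : t ≠ ∞) (p : Prop) [Decidable p]
    {N : ℝ≥0∞} (hN : ¬p → 1 ≤ N) : a * (if p then 0 else 1) ≤ t * a ^ 2 + t⁻¹ * N := by
  split_ifs with hp
  · simp
  · rw [mul_one]
    rcases le_total a t⁻¹ with h | h
    · calc a ≤ t⁻¹ * 1 := by simpa using h
        _ ≤ t⁻¹ * N := by gcongr; exact hN hp
        _ ≤ _ := le_add_self
    · have h1 : 1 ≤ t * a := by
        calc (1 : ℝ≥0∞) = t * t⁻¹ := (ENNReal.mul_inv_cancel ht0 ht).symm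
          _ ≤ t * a := by gcongr
      calc a = 1 * a := (one_mul a).symm
        _ ≤ t * a * a := by gcongr
        _ = t * a ^ 2 := by ring
        _ ≤ _ := le_self_add

section Moments

variable {Ω X : Type*} [MeasurableSpace Ω] [MetricSpace X] [MeasurableSpace X] [BorelSpace X]
  [TopologicalSpace.SeparableSpace X] {η : Ω → Set X} {μ : Measure X} {P : Measure Ω}

theorem IsPoissonProcess.measurable_toENNReal_originDegree (hη : IsPoissonProcess η μ P) (o : X) :
    Measurable fun ω => (originDegree o (η ω) : ℝ≥0∞) := by
  simp_rw [originDegree_eq_tsum]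
  exact Measurable.tsum fun k => hη.measurable_encard_children_inter
    (measurableSet_radialShell o k) (isBounded_radialShell o k) (notMem_radialShell o k)

theorem IsPoissonProcess.measurable_originDegree (hη : IsPoissonProcess η μ P) (o : X) :
    Measurable fun ω => originDegree o (η ω) := by
  refine measurable_to_countable' fun n => ?_
  have h : (fun ω => originDegree o (η ω)) ⁻¹' {n} =
      (fun ω => (originDegree o (η ω) : ℝ≥0∞)) ⁻¹' {(n : ℝ≥0∞)} := by
    ext ω; simp
  rw [h]
  exact hη.measurable_toENNReal_originDegree o (measurableSet_singleton _)

/-- The expected degree of the origin is the integral of the void probabilities of the lenses. -/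
theorem IsPoissonProcess.lintegral_originDegree (hη : IsPoissonProcess η μ P)
    (hμ : ∀ B : Set X, Bornology.IsBounded B → μ B ≠ ∞) (o : X) :
    ∫⁻ ω, (originDegree o (η ω) : ℝ≥0∞) ∂P =
      ∫⁻ x in {o}ᶜ, poissonLaw (μ (radialLens o x)) {0} ∂μ := by
  simp_rw [originDegree_eq_tsum]
  rw [lintegral_tsum fun k => (hη.measurable_encard_children_inter (measurableSet_radialShell o k)
    (isBounded_radialShell o k) (notMem_radialShell o k)).aemeasurable, ← iUnion_radialShell,
    lintegral_iUnion (measurableSet_radialShell o) (pairwise_disjoint_radialShell o)]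
  exact tsum_congr fun k => hη.lintegral_encard_children_inter hμ (measurableSet_radialShell o k)
    (isBounded_radialShell o k) (notMem_radialShell o k)

theorem IsPoissonProcess.lintegral_originDegree_pow_lt_top [IsProbabilityMeasure P]
    (hη : IsPoissonProcess η μ P) (hμ : ∀ B : Set X, Bornology.IsBounded B → μ B ≠ ∞) (o : X)
    {C q : ℝ≥0∞} (hC : C ≠ ∞) (hq : q ≠ ∞) (hq0 : q ≠ 0)
    (hball : ∀ k : ℕ, μ (Metric.ball o (k + 1)) + 1 ≤ C * q ^ k)
    (hvoid : ∀ a : ℝ≥0∞, a ≠ ∞ → ∑' k : ℕ, a ^ k *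
      ∫⁻ x in radialShell o k, poissonLaw (μ (radialLens o x)) {0} ∂μ ≠ ∞) (n : ℕ) :
    ∫⁻ ω, (originDegree o (η ω) : ℝ≥0∞) ^ n ∂P < ∞ := by
  classical
  rcases eq_or_ne n 0 with rfl | hn
  · simp
  obtain ⟨D, hD, hmom⟩ := exists_poissonLaw_moment_le (n * 2)
  -- The 2n-th moment of the count in the k-th ball is of order q^(2nk); dividing by a^k leaves the
  -- summable 2^(-k). The price a^k on the void probabilities is covered by `hvoid`.
  set a : ℝ≥0∞ := 2 * q ^ (n * 2) with ha
  have ha0 : a ≠ 0 := by simp [ha, hq0]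
  have hat : a ≠ ∞ := by finiteness
  have hN : ∀ k, Measurable fun ω => ((originChildren o (η ω) ∩ radialShell o k).encard : ℝ≥0∞) :=
    fun k => hη.measurable_encard_children_inter
      (measurableSet_radialShell o k) (isBounded_radialShell o k) (notMem_radialShell o k)
  have hB : ∀ k : ℕ, Measurable fun ω => ((η ω ∩ Metric.ball o ((k : ℝ) + 1)).encard : ℝ≥0∞) :=
    fun k => hη.measurable_toENNReal_count Metric.isOpen_ball.measurableSet
  have hpt : ∀ ω, (originDegree o (η ω) : ℝ≥0∞) ^ n ≤
      ∑' k : ℕ, ((a ^ k)⁻¹ * ((η ω ∩ Metric.ball o ((k : ℝ) + 1)).encard : ℝ≥0∞) ^ (n * 2) +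
        a ^ k * ((originChildren o (η ω) ∩ radialShell o k).encard : ℝ≥0∞)) := by
    intro ω
    refine (originDegree_pow_le o (η ω) hn).trans (ENNReal.tsum_le_tsum fun k => ?_)
    rw [pow_mul]
    have := ENNReal.mul_ite_le (a := ((η ω ∩ Metric.ball o ((k : ℝ) + 1)).encard : ℝ≥0∞) ^ n)
      (t := (a ^ k)⁻¹) (by simp [hat]) (by simp [ha0])
      (originChildren o (η ω) ∩ radialShell o k = ∅)
      (N := ((originChildren o (η ω) ∩ radialShell o k).encard : ℝ≥0∞)) (fun h => by
        rw [← ENat.toENNReal_one, ENat.toENNReal_le, Set.one_le_encard_iff_nonempty]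
        exact Set.nonempty_iff_ne_empty.2 h)
    rwa [inv_inv] at this
  refine (lintegral_mono hpt).trans_lt ?_
  have hmeas : ∀ k : ℕ, Measurable fun ω =>
      (a ^ k)⁻¹ * ((η ω ∩ Metric.ball o ((k : ℝ) + 1)).encard : ℝ≥0∞) ^ (n * 2) +
        a ^ k * ((originChildren o (η ω) ∩ radialShell o k).encard : ℝ≥0∞) := fun k =>
    (((hB k).pow_const _).const_mul _).add ((hN k).const_mul _)
  rw [lintegral_tsum fun k => (hmeas k).aemeasurable]
  have hterm : ∀ k : ℕ, ∫⁻ ω, ((a ^ k)⁻¹ *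
        ((η ω ∩ Metric.ball o ((k : ℝ) + 1)).encard : ℝ≥0∞) ^ (n * 2) +
        a ^ k * ((originChildren o (η ω) ∩ radialShell o k).encard : ℝ≥0∞)) ∂P ≤
      D * C ^ (n * 2) * 2⁻¹ ^ k +
        a ^ k * ∫⁻ x in radialShell o k, poissonLaw (μ (radialLens o x)) {0} ∂μ := by
    intro k
    rw [lintegral_add_left (((hB k).pow_const _).const_mul _),
      lintegral_const_mul _ ((hB k).pow_const _), lintegral_const_mul _ (hN k),
      hη.lintegral_encard_children_inter hμ (measurableSet_radialShell o k)
        (isBounded_radialShell o k) (notMem_radialShell o k),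
      hη.lintegral_count Metric.isOpen_ball.measurableSet fun x => (x : ℝ≥0∞) ^ (n * 2)]
    refine add_le_add ?_ le_rfl
    calc _ ≤ (a ^ k)⁻¹ * (D * (C * q ^ k) ^ (n * 2)) := by
          gcongr
          refine (hmom _ (hμ _ Metric.isBounded_ball)).trans ?_
          gcongr
          exact hball k
      _ = D * C ^ (n * 2) * (2⁻¹ ^ k * ((q ^ (n * 2 * k))⁻¹ * q ^ (n * 2 * k))) := by
          rw [ha, mul_pow, mul_pow, ENNReal.mul_inv (by simp) (by simp), ENNReal.inv_pow (a := 2),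
            ← pow_mul, ← pow_mul, mul_comm k]
          ring
      _ = _ := by
          rw [ENNReal.inv_mul_cancel (by simp [hq0]) (by finiteness), mul_one]
  refine (ENNReal.tsum_le_tsum hterm).trans_lt ?_
  rw [ENNReal.tsum_add, ENNReal.tsum_mul_left, ENNReal.tsum_geometric]
  refine ENNReal.add_lt_top.2 ⟨?_, (hvoid a hat).lt_top⟩
  rw [ENNReal.one_sub_inv_two, inv_inv]
  finiteness

end Moments

/-! ### Unboundedness of the degree -/

/-- In each small ball the point of `ξ` closest to o is a child of o. Its lens contains no point of
its own ball by minimality, none of another ball because that ball is too far away, and no other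
point because the rest of the large ball is void. -/
theorem natCast_le_originDegree {X : Type*} [MetricSpace X] {o : X} {ξ : Set X} {n : ℕ}
    {p : Fin n → X} {ε R : ℝ} (hsep : ∀ i j, i ≠ j → dist o (p i) + 3 * ε ≤ dist (p i) (p j))
    (hpo : ∀ i, ε ≤ dist o (p i)) (hR : ∀ i, dist o (p i) + ε ≤ R)
    (hfin : ∀ B : Set X, Bornology.IsBounded B → (ξ ∩ B).Finite)
    (hne : ∀ i, (ξ ∩ Metric.ball (p i) ε).Nonempty)
    (hvoid : ξ ∩ (Metric.ball o R \ ⋃ i, Metric.ball (p i) ε) = ∅) :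
    (n : ℕ∞) ≤ originDegree o ξ := by
  have hmin : ∀ i, ∃ x ∈ ξ ∩ Metric.ball (p i) ε, ∀ z ∈ ξ ∩ Metric.ball (p i) ε,
      dist o x ≤ dist o z := fun i =>
    Set.exists_min_image _ _ (hfin _ Metric.isBounded_ball) (hne i)
  choose x hx hxmin using hmin
  have hxd : ∀ i, dist (x i) (p i) < ε := fun i => (hx i).2
  have hxinj : Function.Injective x := by
    intro i j hij
    by_contra hne
    have h1 := hsep i j hne
    have h2 := dist_triangle_left (p i) (p j) (x i)
    have h3 := hxd i
    have h4 := hxd j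
    rw [← hij] at h4
    have h5 := hpo i
    linarith [dist_nonneg (x := x i) (y := p i)]
  have hch : Set.range x ⊆ originChildren o ξ := by
    rintro _ ⟨i, rfl⟩
    have hi := hxd i
    refine ⟨(hx i).1, ?_, ?_⟩
    · intro h
      have := hpo i
      rw [h] at hi
      linarith
    · rw [Set.eq_empty_iff_forall_notMem] at hvoid ⊢
      rintro z ⟨hz, hzl⟩
      rw [mem_radialLens] at hzl
      have h1 := dist_triangle o (p i) (x i)
      rw [dist_comm (p i)] at h1
      refine hvoid z ⟨hz, Metric.mem_ball'.2 (by linarith [hR i, hzl.1]), fun hzU => ?_⟩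
      obtain ⟨j, hj⟩ := Set.mem_iUnion.1 hzU
      by_cases hij : i = j
      · subst hij
        exact absurd (hxmin i z ⟨hz, hj⟩) (not_le.2 hzl.1)
      · have h2 := hsep i j hij
        -- The 3ε of `hsep`: one ε each for x i near p i, for z near p j, and for comparing dist o
        -- (x i) with dist o (p i).
        have h3 := dist_triangle4 (p i) (x i) z (p j)
        rw [dist_comm (p i) (x i)] at h3
        have h4 : dist z (p j) < ε := hj
        linarith [hzl.2]
  rw [originDegree_eq_encard]
  refine le_trans ?_ (Set.encard_le_encard hch)
  simpa using hxinj.encard_range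

/-- The strict inequalities `hsep` leave room for balls of a common radius ε. Hitting each ball and
missing the remainder are events on n + 1 disjoint sets, hence independent, and each has positive
probability. -/
theorem IsPoissonProcess.measure_le_originDegree_pos {Ω X : Type*} [MeasurableSpace Ω]
    [MetricSpace X] [MeasurableSpace X] [BorelSpace X] {η : Ω → Set X} {μ : Measure X}
    {P : Measure Ω} (hη : IsPoissonProcess η μ P)
    (hμ : ∀ B : Set X, Bornology.IsBounded B → μ B ≠ ∞)
    (hpos : ∀ x r, 0 < r → μ (Metric.ball x r) ≠ 0) {o : X} {n : ℕ} (p : Fin n → X)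
    (hsep : ∀ i j, i ≠ j → dist o (p i) < dist (p i) (p j)) (hpo : ∀ i, p i ≠ o) :
    0 < P {ω | (n : ℕ∞) ≤ originDegree o (η ω)} := by
  obtain ⟨ε, hε, hε1, hε2⟩ : ∃ ε > 0, (∀ i j, i ≠ j → dist o (p i) + 3 * ε ≤ dist (p i) (p j)) ∧
      ∀ i, ε ≤ dist o (p i) := by
    have h1 : ∀ᶠ ε in nhdsWithin (0 : ℝ) (Set.Ioi 0),
        ∀ i j, i ≠ j → dist o (p i) + 3 * ε ≤ dist (p i) (p j) := by
      rw [Filter.eventually_all]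
      intro i
      rw [Filter.eventually_all]
      intro j
      by_cases hij : i = j
      · simp [hij]
      · have : Filter.Tendsto (fun ε : ℝ => dist o (p i) + 3 * ε) (nhds 0)
            (nhds (dist o (p i) + 3 * 0)) := Continuous.tendsto (by fun_prop) 0
        filter_upwards [(this.eventually_lt_const (by simpa using hsep i j hij)).filter_mono
          nhdsWithin_le_nhds] with ε h _
        exact h.le
    have h2 : ∀ᶠ ε in nhdsWithin (0 : ℝ) (Set.Ioi 0), ∀ i, ε ≤ dist o (p i) := by
      rw [Filter.eventually_all]
      intro i
      exact (eventually_le_nhds (dist_pos.2 (hpo i).symm)).filter_mono nhdsWithin_le_nhds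
    obtain ⟨ε, h⟩ := ((h1.and h2).and self_mem_nhdsWithin).exists
    exact ⟨ε, h.2, h.1.1, h.1.2⟩
  obtain ⟨R, hR⟩ : ∃ R, ∀ i, dist o (p i) + ε ≤ R :=
    ⟨∑ i, (dist o (p i) + ε), fun i => Finset.single_le_sum
      (f := fun i => dist o (p i) + ε) (fun i _ => by positivity) (Finset.mem_univ i)⟩
  set rest : Set X := Metric.ball o R \ ⋃ i, Metric.ball (p i) ε with hrest
  have hrestm : MeasurableSet rest := Metric.isOpen_ball.measurableSet.diff
    (isOpen_iUnion fun _ => Metric.isOpen_ball).measurableSet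
  set B : Fin (n + 1) → Set X := Fin.cons rest fun i => Metric.ball (p i) ε with hB
  set S : Fin (n + 1) → Set ℕ∞ := Fin.cons {0} fun _ => {0}ᶜ with hS
  have hBm : ∀ i, MeasurableSet (B i) := by
    intro i
    refine Fin.cases hrestm (fun i => ?_) i
    exact Metric.isOpen_ball.measurableSet
  have hBd : Pairwise (Function.onFun Disjoint B) := by
    have h0 : ∀ i, Disjoint rest (Metric.ball (p i) ε) := fun i =>
      Set.disjoint_left.2 fun x hx hxi => hx.2 (Set.mem_iUnion.2 ⟨i, hxi⟩)
    intro i j hij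
    refine Fin.cases (fun j hij => ?_) (fun i j hij => ?_) i j hij
    · refine Fin.cases (fun h => absurd rfl h) (fun j _ => ?_) j hij
      exact h0 j
    · refine Fin.cases (fun _ => (h0 i).symm) (fun j h => ?_) j hij
      have hne : i ≠ j := fun h' => h (by rw [h'])
      refine Metric.ball_disjoint_ball ?_
      linarith [hε1 i j hne, dist_nonneg (x := o) (y := p i)]
  have hmul := (iIndepFun_iff_measure_inter_preimage_eq_mul.1 (hη.indep_count (n + 1) B hBm hBd))
    Finset.univ (sets := S) (fun i _ => .of_discrete)
  have hprod : 0 < ∏ i, P ((fun ω => (η ω ∩ B i).encard) ⁻¹' S i) := by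
    refine pos_iff_ne_zero.2 (Finset.prod_ne_zero_iff.2 fun i _ => ?_)
    rw [← Measure.map_apply (hη.measurable_count _ (hBm i)) .of_discrete, hη.law_count _ (hBm i)]
    refine Fin.cases ?_ (fun i => ?_) i
    · change poissonLaw (μ rest) {0} ≠ 0
      rw [poissonLaw_singleton_zero (hμ _ (Metric.isBounded_ball.subset Set.sdiff_subset))]
      simp [Real.exp_pos]
    · exact (poissonLaw_singleton_zero_compl_pos (hpos _ _ hε)).ne'
  rw [← hmul] at hprod
  refine hprod.trans_le (measure_mono fun ω hω => ?_)
  simp only [Finset.mem_univ, Set.iInter_true, Set.mem_iInter, Set.mem_preimage] at hω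
  refine natCast_le_originDegree hε1 hε2 hR (hη.locallyFinite ω) (fun i => ?_) ?_
  · have := hω i.succ
    simpa [hB, hS, Set.nonempty_iff_ne_empty] using this
  · have := hω 0
    simpa [hB, hS] using this

/-! ### The hyperbolic volume in the half-space model -/

theorem Real.sinh_le_mul_cosh {x : ℝ} (hx : 0 ≤ x) : Real.sinh x ≤ x * Real.cosh x := by
  have hd : ∀ y : ℝ, HasDerivAt (fun y => y * Real.cosh y - Real.sinh y) (y * Real.sinh y) y := by
    intro y
    have := ((hasDerivAt_id y).mul (Real.hasDerivAt_cosh y)).sub (Real.hasDerivAt_sinh y)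
    convert! this using 1
    simp
  have hmono : MonotoneOn (fun y => y * Real.cosh y - Real.sinh y) (Set.Ici 0) := by
    refine monotoneOn_of_deriv_nonneg (convex_Ici 0)
      (fun y _ => (hd y).continuousAt.continuousWithinAt)
      (fun y _ => (hd y).differentiableAt.differentiableWithinAt) fun y hy => ?_
    rw [interior_Ici, Set.mem_Ioi] at hy
    rw [(hd y).deriv]
    exact mul_nonneg hy.le (Real.sinh_nonneg_iff.2 hy.le)
  have := hmono Set.self_mem_Ici hx hx
  simpa using this

namespace MeasureTheory.Measure

/-- By second countability countably many of the sets `U` cover; making them disjoint lets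
σ-additivity add up the local inequalities. -/
theorem le_of_locally_le {X : Type*} [TopologicalSpace X] [SecondCountableTopology X]
    [MeasurableSpace X] [OpensMeasurableSpace X] {μ ν : Measure X}
    (h : ∀ x, ∃ U : Set X, IsOpen U ∧ x ∈ U ∧ ∀ A ⊆ U, MeasurableSet A → μ A ≤ ν A) : μ ≤ ν := by
  choose U hUo hxU hU using h
  obtain ⟨s, hs, hcov⟩ := TopologicalSpace.countable_cover_nhds fun x => (hUo x).mem_nhds (hxU x)
  rcases s.eq_empty_or_nonempty with rfl | hne
  · have : IsEmpty X := by
      rw [Set.biUnion_empty] at hcov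
      exact Set.univ_eq_empty_iff.1 hcov.symm
    rw [Measure.eq_zero_of_isEmpty μ]
    exact Measure.zero_le ν
  obtain ⟨f, rfl⟩ := hs.exists_eq_range hne
  rw [Set.biUnion_range] at hcov
  refine Measure.le_iff.2 fun A hA => ?_
  set V := disjointed fun n => U (f n) with hV
  have hVm : ∀ n, MeasurableSet (A ∩ V n) := fun n =>
    hA.inter (MeasurableSet.disjointed (fun n => (hUo (f n)).measurableSet) n)
  have hVd : Pairwise (Function.onFun Disjoint fun n => A ∩ V n) := fun i j hij =>
    (disjoint_disjointed _ hij).mono Set.inter_subset_right Set.inter_subset_right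
  have hAV : A = ⋃ n, A ∩ V n := by
    rw [← Set.inter_iUnion, hV, iUnion_disjointed, hcov, Set.inter_univ]
  rw [hAV, measure_iUnion hVd hVm, measure_iUnion hVd hVm]
  exact ENNReal.tsum_le_tsum fun n => hU (f n) _
    (Set.inter_subset_right.trans (disjointed_subset _ n)) (hVm n)

end MeasureTheory.Measure

theorem LipschitzOnWith.euclideanHausdorffMeasure_image_le {X Y : Type*} [MetricSpace X]
    [MeasurableSpace X] [BorelSpace X] [MetricSpace Y] [MeasurableSpace Y] [BorelSpace Y]
    {K : ℝ≥0} {f : X → Y} {s : Set X} (h : LipschitzOnWith K f s) (d : ℕ) :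
    (Measure.euclideanHausdorffMeasure d : Measure Y) (f '' s) ≤
      (K : ℝ≥0∞) ^ d * (Measure.euclideanHausdorffMeasure d : Measure X) s := by
  rw [Measure.euclideanHausdorffMeasure_def, Measure.euclideanHausdorffMeasure_def,
    Measure.smul_apply, Measure.smul_apply, ENNReal.smul_def, ENNReal.smul_def, smul_eq_mul,
    smul_eq_mul, mul_left_comm]
  gcongr
  simpa using h.hausdorffMeasure_image_le (d := d) (by positivity)

/-! ### Hyperbolic versus Euclidean topology on the half-space -/

namespace HyperbolicSpace

variable {d : ℕ} [NeZero d] {ϰ : ℝ}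

theorem cosh_unitDist (x y : HyperbolicSpace d ϰ) :
    Real.cosh (unitDist x y) = 1 + ‖x.point - y.point‖ ^ 2 / (2 * x.height * y.height) :=
  Real.cosh_arcosh (one_le_arg x y)

theorem abs_height_sub_height_le (x y : HyperbolicSpace d ϰ) :
    |x.height - y.height| ≤ ‖x.point - y.point‖ :=
  PiLp.norm_apply_le (x.point - y.point) ⟨d - 1, Nat.sub_one_lt (NeZero.ne d)⟩

theorem unitDist_le (x y : HyperbolicSpace d ϰ) :
    unitDist x y ≤ ‖x.point - y.point‖ / √(x.height * y.height) := by
  have h := sinh_half_unitDist x y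
  have h1 : unitDist x y / 2 ≤ Real.sinh (unitDist x y / 2) :=
    Real.self_le_sinh_iff.2 (by linarith [unitDist_nonneg x y])
  rw [h] at h1
  have h2 : ‖x.point - y.point‖ / (2 * √(x.height * y.height)) =
      ‖x.point - y.point‖ / √(x.height * y.height) / 2 := by
    rw [mul_comm, div_div]
  linarith

/-- Among points of given heights the distance is least, namely |log(x_d / y_d)|, when they lie on
one vertical line; the comparison is made after applying cosh. -/
theorem height_le_exp_mul (x y : HyperbolicSpace d ϰ) :
    x.height ≤ Real.exp (unitDist x y) * y.height := by
  have hx := x.height_pos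
  have hy := y.height_pos
  by_contra! hlt
  have hlog : unitDist x y < Real.log (x.height / y.height) := by
    rw [Real.lt_log_iff_exp_lt (by positivity), lt_div_iff₀ hy]
    exact hlt
  have h1 := Real.cosh_lt_cosh.2 (show |unitDist x y| < |Real.log (x.height / y.height)| by
    rw [abs_of_nonneg (unitDist_nonneg x y)]
    exact hlog.trans_le (le_abs_self _))
  rw [cosh_unitDist, Real.cosh_log (by positivity)] at h1
  have h2 : (x.height - y.height) ^ 2 ≤ ‖x.point - y.point‖ ^ 2 := by
    rw [← sq_abs]
    exact pow_le_pow_left₀ (abs_nonneg _) (abs_height_sub_height_le x y) 2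
  have h3 : (x.height / y.height + (x.height / y.height)⁻¹) / 2 =
      1 + (x.height - y.height) ^ 2 / (2 * x.height * y.height) := by
    field_simp
    ring
  rw [h3] at h1
  have h4 : (x.height - y.height) ^ 2 / (2 * x.height * y.height) ≤
    ‖x.point - y.point‖ ^ 2 / (2 * x.height * y.height) := by gcongr
  linarith

theorem norm_point_sub_point_sq_le (x y : HyperbolicSpace d ϰ) :
    ‖x.point - y.point‖ ^ 2 ≤
      2 * y.height ^ 2 * Real.exp (unitDist x y) * (Real.cosh (unitDist x y) - 1) := by
  have hx := x.height_pos
  have hy := y.height_pos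
  have h0 : Real.cosh (unitDist x y) - 1 = ‖x.point - y.point‖ ^ 2 / (2 * x.height * y.height) := by
    rw [cosh_unitDist]; ring
  have h1 : ‖x.point - y.point‖ ^ 2 =
      2 * x.height * y.height * (Real.cosh (unitDist x y) - 1) := by
    rw [h0]; field_simp
  rw [h1]
  have h2 := height_le_exp_mul x y
  have h3 : 0 ≤ Real.cosh (unitDist x y) - 1 := by linarith [Real.one_le_cosh (unitDist x y)]
  calc 2 * x.height * y.height * (Real.cosh (unitDist x y) - 1)
      ≤ 2 * (Real.exp (unitDist x y) * y.height) * y.height *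
        (Real.cosh (unitDist x y) - 1) := by gcongr
    _ = _ := by ring

theorem point_injective :
    Function.Injective (point : HyperbolicSpace d ϰ → EuclideanSpace ℝ (Fin d)) :=
  fun _ _ h => HyperbolicSpace.ext h

theorem range_point : Set.range (point : HyperbolicSpace d ϰ → EuclideanSpace ℝ (Fin d)) =
    {x | 0 < x ⟨d - 1, Nat.sub_one_lt (NeZero.ne d)⟩} :=
  Set.Subset.antisymm (by rintro _ ⟨x, rfl⟩; exact x.height_pos) fun x hx => ⟨⟨x, hx⟩, rfl⟩

variable [Fact (0 < ϰ)]

theorem unitDist_eq_sqrt_mul_dist (x y : HyperbolicSpace d ϰ) : unitDist x y = √ϰ * dist x y := by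
  have hϰ : 0 < ϰ := Fact.out
  have : √ϰ ≠ 0 := by positivity
  rw [dist_def]
  field_simp

theorem continuous_point : Continuous (point : HyperbolicSpace d ϰ → EuclideanSpace ℝ (Fin d)) := by
  rw [continuous_iff_continuousAt]
  intro y
  rw [ContinuousAt, tendsto_iff_norm_sub_tendsto_zero]
  have h1 : Filter.Tendsto (fun x => √(2 * y.height ^ 2 * Real.exp (√ϰ * dist x y) *
      (Real.cosh (√ϰ * dist x y) - 1))) (nhds y) (nhds 0) := by
    have hc : Continuous fun x => √(2 * y.height ^ 2 * Real.exp (√ϰ * dist x y) *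
      (Real.cosh (√ϰ * dist x y) - 1)) := by fun_prop
    simpa using hc.tendsto y
  refine squeeze_zero (fun _ => norm_nonneg _) (fun x => ?_) h1
  rw [← unitDist_eq_sqrt_mul_dist]
  exact Real.le_sqrt_of_sq_le (norm_point_sub_point_sq_le x y)

theorem continuous_height : Continuous (height : HyperbolicSpace d ϰ → ℝ) :=
  (EuclideanSpace.proj (𝕜 := ℝ) (⟨d - 1, Nat.sub_one_lt (NeZero.ne d)⟩ : Fin d)).continuous.comp
    continuous_point

theorem isOpenEmbedding_point :
    Topology.IsOpenEmbedding (point : HyperbolicSpace d ϰ → EuclideanSpace ℝ (Fin d)) := by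
  have hϰ : 0 < ϰ := Fact.out
  refine ⟨⟨Topology.isInducing_iff_nhds.2 fun y => ?_, point_injective⟩, ?_⟩
  · refine le_antisymm (continuous_point.tendsto y).le_comap ?_
    have hy := y.height_pos
    rw [← Filter.tendsto_id', tendsto_iff_dist_tendsto_zero]
    set l := Filter.comap (point : HyperbolicSpace d ϰ → _) (nhds y.point) with hl
    have hpt : Filter.Tendsto (point : HyperbolicSpace d ϰ → _) l (nhds y.point) :=
      Filter.tendsto_comap
    have hh : Filter.Tendsto (height : HyperbolicSpace d ϰ → _) l (nhds y.height) :=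
      ((EuclideanSpace.proj (𝕜 := ℝ)
        (⟨d - 1, Nat.sub_one_lt (NeZero.ne d)⟩ : Fin d)).continuous.tendsto y.point).comp hpt
    have h1 : Filter.Tendsto
        (fun x => 1 / √ϰ * (‖x.point - y.point‖ / √(x.height * y.height))) l (nhds 0) := by
      have h2 := (((hpt.sub_const y.point).norm).div ((hh.mul_const y.height).sqrt)
        (by positivity)).const_mul (1 / √ϰ)
      simpa using h2
    refine squeeze_zero (fun _ => dist_nonneg) (fun x => ?_) h1
    rw [id, dist_def]
    gcongr
    exact unitDist_le x y
  · rw [range_point]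
    exact isOpen_lt continuous_const (EuclideanSpace.proj (𝕜 := ℝ)
      (⟨d - 1, Nat.sub_one_lt (NeZero.ne d)⟩ : Fin d)).continuous

instance : SecondCountableTopology (HyperbolicSpace d ϰ) :=
  isOpenEmbedding_point.isInducing.secondCountableTopology

theorem measurableEmbedding_point :
    MeasurableEmbedding (point : HyperbolicSpace d ϰ → EuclideanSpace ℝ (Fin d)) :=
  isOpenEmbedding_point.measurableEmbedding

/-- The density of the hyperbolic volume with respect to Lebesgue measure. -/
noncomputable def volumeDensity (ϰ : ℝ) (d : ℕ) [NeZero d] (x : EuclideanSpace ℝ (Fin d)) : ℝ≥0∞ :=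
  ENNReal.ofReal ((√ϰ * x ⟨d - 1, Nat.sub_one_lt (NeZero.ne d)⟩)⁻¹ ^ d)

end HyperbolicSpace

/-! ### Hausdorff measure in the half-space through local near-isometries -/

namespace HyperbolicSpace

variable {d : ℕ} [NeZero d] {ϰ : ℝ}

/-- The points whose Euclidean distance to `p` is less than `ε` times the height of `p`. -/
def relBall (p : HyperbolicSpace d ϰ) (ε : ℝ) : Set (HyperbolicSpace d ϰ) :=
  {x | ‖x.point - p.point‖ < ε * p.height}

theorem height_mem_of_mem_relBall {p x : HyperbolicSpace d ϰ} {ε : ℝ} (hx : x ∈ relBall p ε) :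
    (1 - ε) * p.height ≤ x.height ∧ x.height ≤ (1 + ε) * p.height := by
  have h1 : ‖x.point - p.point‖ < ε * p.height := hx
  have h2 := abs_le.1 (abs_height_sub_height_le x p)
  constructor <;> linarith [h2.1, h2.2]

theorem mem_relBall_self (p : HyperbolicSpace d ϰ) {ε : ℝ} (hε : 0 < ε) : p ∈ relBall p ε := by
  change ‖p.point - p.point‖ < ε * p.height
  simpa using mul_pos hε p.height_pos

variable [Fact (0 < ϰ)]

theorem dist_le_of_mem_relBall {p x y : HyperbolicSpace d ϰ} {ε : ℝ} (hε : ε < 1)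
    (hx : x ∈ relBall p ε) (hy : y ∈ relBall p ε) :
    dist x y ≤ ((1 - ε) * (√ϰ * p.height))⁻¹ * ‖x.point - y.point‖ := by
  have hϰ : 0 < ϰ := Fact.out
  have hp := p.height_pos
  have h1 : (1 - ε) * p.height ≤ √(x.height * y.height) := by
    refine Real.le_sqrt_of_sq_le ?_
    rw [sq]
    have : 0 ≤ (1 - ε) * p.height := mul_nonneg (by linarith) hp.le
    exact mul_le_mul (height_mem_of_mem_relBall hx).1 (height_mem_of_mem_relBall hy).1 this
      x.height_pos.le
  have h2 : 0 < (1 - ε) * p.height := mul_pos (by linarith) hp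
  calc dist x y = 1 / √ϰ * unitDist x y := dist_def x y
    _ ≤ 1 / √ϰ * (‖x.point - y.point‖ / √(x.height * y.height)) := by
        gcongr; exact unitDist_le x y
    _ ≤ 1 / √ϰ * (‖x.point - y.point‖ / ((1 - ε) * p.height)) := by gcongr
    _ = _ := by
        have : 1 - ε ≠ 0 := by linarith
        field_simp

theorem norm_sub_le_of_mem_relBall {p x y : HyperbolicSpace d ϰ} {ε : ℝ} (hε0 : 0 < ε)
    (hε : ε ≤ 1 / 4) (hx : x ∈ relBall p ε) (hy : y ∈ relBall p ε) :
    ‖x.point - y.point‖ ≤ (1 + ε) ^ 2 * (√ϰ * p.height) * dist x y := by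
  have hϰ : 0 < ϰ := Fact.out
  have hp := p.height_pos
  have hxp := x.height_pos
  have hyp := y.height_pos
  have hxh := height_mem_of_mem_relBall hx
  have hyh := height_mem_of_mem_relBall hy
  set S := √(x.height * y.height) with hS
  have hS0 : 0 < S := Real.sqrt_pos.2 (by positivity)
  have hSu : S ≤ (1 + ε) * p.height := by
    refine Real.sqrt_le_iff.2 ⟨by positivity, ?_⟩
    rw [sq]
    exact mul_le_mul hxh.2 hyh.2 hyp.le (by positivity)
  have hSl : (1 - ε) * p.height ≤ S := by
    refine Real.le_sqrt_of_sq_le ?_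
    rw [sq]
    have : 0 ≤ (1 - ε) * p.height := mul_nonneg (by linarith) hp.le
    exact mul_le_mul hxh.1 hyh.1 this hxp.le
  have hxy : ‖x.point - y.point‖ ≤ 2 * ε * p.height := by
    have h1 : ‖x.point - p.point‖ < ε * p.height := hx
    have h2 : ‖y.point - p.point‖ < ε * p.height := hy
    have h3 := norm_sub_le (x.point - p.point) (y.point - p.point)
    rw [sub_sub_sub_cancel_right] at h3
    linarith
  have hsinh := sinh_half_unitDist x y
  rw [← hS] at hsinh
  have hnorm : ‖x.point - y.point‖ = 2 * S * Real.sinh (unitDist x y / 2) := by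
    rw [hsinh]; field_simp
  -- The norm is at most 2ε times the height of p, and 2S is at least 3/2 of that height because ε ≤
  -- 1/4.
  have hs1 : Real.sinh (unitDist x y / 2) ≤ 4 / 3 * ε := by
    rw [hsinh, div_le_iff₀ (by positivity)]
    have h34 : 3 / 4 * p.height ≤ (1 - ε) * p.height := by gcongr; linarith
    nlinarith
  have hc : Real.cosh (unitDist x y / 2) ≤ 1 + ε := by
    refine abs_le_of_sq_le_sq' ?_ (by positivity) |>.2
    have hs0 : 0 ≤ Real.sinh (unitDist x y / 2) :=
      Real.sinh_nonneg_iff.2 (by linarith [unitDist_nonneg x y])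
    rw [Real.cosh_sq]
    nlinarith
  have hD := unitDist_nonneg x y
  have hsc := Real.sinh_le_mul_cosh (x := unitDist x y / 2) (by linarith)
  rw [hnorm]
  calc 2 * S * Real.sinh (unitDist x y / 2)
      ≤ 2 * ((1 + ε) * p.height) * (unitDist x y / 2 * (1 + ε)) := by
        gcongr
        exact hsc.trans (by gcongr)
    _ = _ := by rw [unitDist_eq_sqrt_mul_dist]; ring

/-- The measure with the hyperbolic volume density. -/
noncomputable def densityVolume (d : ℕ) [NeZero d] (ϰ : ℝ) [Fact (0 < ϰ)] :
    Measure (HyperbolicSpace d ϰ) :=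
  Measure.comap point (volume.withDensity (volumeDensity ϰ d))

theorem densityVolume_apply {A : Set (HyperbolicSpace d ϰ)} (hA : MeasurableSet A) :
    densityVolume d ϰ A = ∫⁻ x in point '' A, volumeDensity ϰ d x := by
  rw [densityVolume, measurableEmbedding_point.comap_apply,
    withDensity_apply _ (measurableEmbedding_point.measurableSet_image.2 hA)]

/-- On a small relative ball both the metric and the density are almost those at p. The factor,
which tends to 1 with ε, is larger than needed here so that it serves both directions. -/
theorem hyperbolicVolume_le_of_subset_relBall {p : HyperbolicSpace d ϰ} {ε : ℝ} (hε0 : 0 < ε)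
    (hε : ε ≤ 1 / 4) {A : Set (HyperbolicSpace d ϰ)} (hA : A ⊆ relBall p ε)
    (hAm : MeasurableSet A) :
    hyperbolicVolume d ϰ A ≤
      ENNReal.ofReal (((1 + ε) ^ 2 / (1 - ε)) ^ d) * densityVolume d ϰ A := by
  have hϰ : 0 < ϰ := Fact.out
  have hp := p.height_pos
  have h1ε : 0 < 1 - ε := by linarith
  have : Nonempty (HyperbolicSpace d ϰ) := ⟨p⟩
  set g := Function.invFun (point : HyperbolicSpace d ϰ → _) with hg
  have hgp : ∀ x : HyperbolicSpace d ϰ, g x.point = x :=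
    Function.leftInverse_invFun point_injective
  set K : ℝ := ((1 - ε) * (√ϰ * p.height))⁻¹ with hK
  have hK0 : 0 ≤ K := by positivity
  have hlip : LipschitzOnWith K.toNNReal g (point '' A) := by
    refine LipschitzOnWith.of_dist_le_mul ?_
    rintro _ ⟨x, hx, rfl⟩ _ ⟨y, hy, rfl⟩
    rw [hgp, hgp, Real.coe_toNNReal _ hK0, dist_eq_norm]
    exact dist_le_of_mem_relBall (by linarith) (hA hx) (hA hy)
  have himg : g '' (point '' A) = A := by
    rw [Set.image_image]; simp [hgp]
  have h1 := hlip.euclideanHausdorffMeasure_image_le d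
  rw [himg, EuclideanSpace.euclideanHausdorffMeasure_eq_volume] at h1
  have h2 : ENNReal.ofReal (((1 + ε) * (√ϰ * p.height))⁻¹ ^ d) * volume (point '' A) ≤
      densityVolume d ϰ A := by
    rw [densityVolume_apply hAm, ← setLIntegral_const]
    refine setLIntegral_mono' (measurableEmbedding_point.measurableSet_image.2 hAm) ?_
    rintro _ ⟨x, hx, rfl⟩
    refine ENNReal.ofReal_le_ofReal ?_
    have hxp := x.height_pos
    change _ ≤ (√ϰ * x.height)⁻¹ ^ d
    refine pow_le_pow_left₀ (by positivity) (inv_anti₀ (by positivity) ?_) d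
    calc √ϰ * x.height ≤ √ϰ * ((1 + ε) * p.height) := by
          gcongr; exact (height_mem_of_mem_relBall (hA hx)).2
      _ = _ := by ring
  refine h1.trans (le_trans ?_ (mul_le_mul_right h2 _))
  rw [← mul_assoc, ← ENNReal.ofReal_mul (by positivity), ← mul_pow]
  gcongr
  rw [← ENNReal.ofReal, ← ENNReal.ofReal_pow hK0]
  refine ENNReal.ofReal_le_ofReal (pow_le_pow_left₀ hK0 ?_ d)
  have : (1 + ε) ^ 2 / (1 - ε) * ((1 + ε) * (√ϰ * p.height))⁻¹ = (1 + ε) * K := by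
    rw [hK]; field_simp
  rw [this]
  nlinarith

theorem densityVolume_le_of_subset_relBall {p : HyperbolicSpace d ϰ} {ε : ℝ} (hε0 : 0 < ε)
    (hε : ε ≤ 1 / 4) {A : Set (HyperbolicSpace d ϰ)} (hA : A ⊆ relBall p ε)
    (hAm : MeasurableSet A) :
    densityVolume d ϰ A ≤
      ENNReal.ofReal (((1 + ε) ^ 2 / (1 - ε)) ^ d) * hyperbolicVolume d ϰ A := by
  have hϰ : 0 < ϰ := Fact.out
  have hp := p.height_pos
  have h1ε : 0 < 1 - ε := by linarith
  set K : ℝ := (1 + ε) ^ 2 * (√ϰ * p.height) with hK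
  have hK0 : 0 ≤ K := by positivity
  have hlip : LipschitzOnWith K.toNNReal (point : HyperbolicSpace d ϰ → _) A := by
    refine LipschitzOnWith.of_dist_le_mul fun x hx y hy => ?_
    rw [Real.coe_toNNReal _ hK0, dist_eq_norm]
    exact norm_sub_le_of_mem_relBall hε0 hε (hA hx) (hA hy)
  have h1 := hlip.euclideanHausdorffMeasure_image_le d
  rw [EuclideanSpace.euclideanHausdorffMeasure_eq_volume] at h1
  have h2 : densityVolume d ϰ A ≤
      ENNReal.ofReal (((1 - ε) * (√ϰ * p.height))⁻¹ ^ d) * volume (point '' A) := by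
    rw [densityVolume_apply hAm, ← setLIntegral_const]
    refine setLIntegral_mono' (measurableEmbedding_point.measurableSet_image.2 hAm) ?_
    rintro _ ⟨x, hx, rfl⟩
    refine ENNReal.ofReal_le_ofReal ?_
    have hxp := x.height_pos
    change (√ϰ * x.height)⁻¹ ^ d ≤ _
    refine pow_le_pow_left₀ (by positivity) (inv_anti₀ (by positivity) ?_) d
    calc _ = √ϰ * ((1 - ε) * p.height) := by ring
      _ ≤ √ϰ * x.height := by
          gcongr; exact (height_mem_of_mem_relBall (hA hx)).1
  refine h2.trans ((mul_le_mul_right h1 _).trans ?_)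
  rw [← ENNReal.ofReal, ← ENNReal.ofReal_pow hK0, ← mul_assoc,
    ← ENNReal.ofReal_mul (by positivity), ← mul_pow]
  have : ((1 - ε) * (√ϰ * p.height))⁻¹ * K = (1 + ε) ^ 2 / (1 - ε) := by
    rw [hK]; field_simp
  rw [this]
  exact le_rfl

theorem isOpen_relBall (p : HyperbolicSpace d ϰ) (ε : ℝ) : IsOpen (relBall p ε) :=
  isOpen_lt (continuous_point.sub continuous_const).norm continuous_const

theorem tendsto_distortion (d : ℕ) :
    Filter.Tendsto (fun ε : ℝ => ENNReal.ofReal (((1 + ε) ^ 2 / (1 - ε)) ^ d))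
      (nhdsWithin 0 (Set.Ioi 0)) (nhds 1) := by
  have h : ContinuousAt (fun ε : ℝ => ((1 + ε) ^ 2 / (1 - ε)) ^ d) 0 := by
    refine ContinuousAt.pow (ContinuousAt.div (by fun_prop) (by fun_prop) (by simp)) d
  have h' := (ENNReal.tendsto_ofReal h.tendsto).mono_left
    (nhdsWithin_le_nhds (s := Set.Ioi (0 : ℝ)))
  simpa using h'

theorem le_of_forall_distortion {X : Type*} [MeasurableSpace X] {μ ν : Measure X} {d : ℕ}
    (h : ∀ ε : ℝ, 0 < ε → ε ≤ 1 / 4 → μ ≤ ENNReal.ofReal (((1 + ε) ^ 2 / (1 - ε)) ^ d) • ν) :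
    μ ≤ ν := by
  refine Measure.le_iff.2 fun A _ => ?_
  have h1 := ENNReal.Tendsto.mul_const (b := ν A) (tendsto_distortion d) (Or.inl one_ne_zero)
  rw [one_mul] at h1
  refine ge_of_tendsto h1 ?_
  filter_upwards [Ioc_mem_nhdsGT (show (0 : ℝ) < 1 / 4 by norm_num)] with ε hε
  exact h ε hε.1 hε.2 A

/-- In the half-space model the hyperbolic volume has the density `(√ϰ x_d)^{-d}`. -/
theorem hyperbolicVolume_eq_densityVolume : hyperbolicVolume d ϰ = densityVolume d ϰ := by
  -- For fixed ε the local comparisons globalise with the same factor; only then does ε tend to 0.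
  refine le_antisymm (le_of_forall_distortion (d := d) fun ε hε0 hε => ?_)
    (le_of_forall_distortion (d := d) fun ε hε0 hε => ?_)
  · exact Measure.le_of_locally_le fun p => ⟨relBall p ε, isOpen_relBall p ε,
      mem_relBall_self p hε0, fun A hA hAm => hyperbolicVolume_le_of_subset_relBall hε0 hε hA hAm⟩
  · exact Measure.le_of_locally_le fun p => ⟨relBall p ε, isOpen_relBall p ε,
      mem_relBall_self p hε0, fun A hA hAm => densityVolume_le_of_subset_relBall hε0 hε hA hAm⟩

end HyperbolicSpace

/-! ### Splitting off the last coordinate -/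

namespace EuclideanSpace

variable {m : ℕ}

/-- The point of `ℝ^{m+1}` with last coordinate `p.1` and the other coordinates given by `p.2`. -/
noncomputable def joinLast (p : ℝ × EuclideanSpace ℝ (Fin m)) : EuclideanSpace ℝ (Fin (m + 1)) :=
  WithLp.toLp 2 (Fin.snoc (α := fun _ => ℝ) p.2 p.1)

@[simp]
theorem joinLast_last (p : ℝ × EuclideanSpace ℝ (Fin m)) : joinLast p (Fin.last m) = p.1 := by
  simp [joinLast]

@[simp]
theorem joinLast_castSucc (p : ℝ × EuclideanSpace ℝ (Fin m)) (i : Fin m) :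
    joinLast p i.castSucc = p.2 i := by
  simp [joinLast]

theorem joinLast_sub (p q : ℝ × EuclideanSpace ℝ (Fin m)) :
    joinLast p - joinLast q = joinLast (p - q) := by
  ext i
  refine Fin.lastCases ?_ (fun i => ?_) i <;> simp

theorem inner_joinLast (p q : ℝ × EuclideanSpace ℝ (Fin m)) :
    inner ℝ (joinLast p) (joinLast q) = p.1 * q.1 + inner ℝ p.2 q.2 := by
  simp only [PiLp.inner_apply, Fin.sum_univ_castSucc, joinLast_castSucc, joinLast_last]
  simp [mul_comm, add_comm]

theorem norm_joinLast_sq (p : ℝ × EuclideanSpace ℝ (Fin m)) :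
    ‖joinLast p‖ ^ 2 = p.1 ^ 2 + ‖p.2‖ ^ 2 := by
  rw [← real_inner_self_eq_norm_sq, inner_joinLast, real_inner_self_eq_norm_sq, ← sq]

theorem measurePreserving_joinLast :
    MeasurePreserving (joinLast (m := m)) (volume : Measure (ℝ × EuclideanSpace ℝ (Fin m)))
      volume := by
  have h1 := (MeasurePreserving.id (volume : Measure ℝ)).prod
    (EuclideanSpace.volume_preserving_symm_measurableEquiv_toLp (Fin m))
  have h2 := (volume_preserving_piFinSuccAbove (fun _ : Fin (m + 1) => ℝ) (Fin.last m)).symm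
  have h3 := (EuclideanSpace.volume_preserving_symm_measurableEquiv_toLp (Fin (m + 1))).symm
  convert! h3.comp (h2.comp h1) using 1
  ext p i
  refine Fin.lastCases ?_ (fun i => ?_) i
  · simp [MeasurableEquiv.piFinSuccAbove]
  · simp [MeasurableEquiv.piFinSuccAbove]

theorem measurable_joinLast : Measurable (joinLast (m := m)) := measurePreserving_joinLast.measurable

theorem lintegral_eq_lintegral_joinLast {f : EuclideanSpace ℝ (Fin (m + 1)) → ℝ≥0∞}
    (hf : Measurable f) : ∫⁻ x, f x = ∫⁻ y : ℝ, ∫⁻ w : EuclideanSpace ℝ (Fin m), f (joinLast (y, w)) := by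
  rw [← measurePreserving_joinLast.lintegral_comp hf, Measure.volume_eq_prod]
  exact lintegral_prod _ (hf.comp measurable_joinLast).aemeasurable

end EuclideanSpace

/-! ### One-dimensional substitutions -/

theorem lintegral_Ioi_inv_mul_eq_lintegral_exp {k : ℝ} (hk : 0 < k) (g : ℝ → ℝ≥0∞) :
    ∫⁻ y in Set.Ioi (0 : ℝ), ENNReal.ofReal y⁻¹ * g y = ∫⁻ s : ℝ, g (k * Real.exp s) := by
  have himg : (fun s : ℝ => k * Real.exp s) '' Set.univ = Set.Ioi 0 := by
    rw [Set.image_univ]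
    ext y
    constructor
    · rintro ⟨s, rfl⟩
      exact mul_pos hk (Real.exp_pos s)
    · intro hy
      refine ⟨Real.log (y / k), ?_⟩
      have hy : 0 < y := hy
      change k * Real.exp (Real.log (y / k)) = y
      rw [Real.exp_log (by positivity)]
      field_simp
  rw [← himg, lintegral_image_eq_lintegral_abs_deriv_mul MeasurableSet.univ
    (fun s _ => ((Real.hasDerivAt_exp s).const_mul k).hasDerivWithinAt), Measure.restrict_univ]
  · refine lintegral_congr fun s => ?_
    have : 0 < k * Real.exp s := mul_pos hk (Real.exp_pos s)
    rw [abs_of_pos this, ← mul_assoc, ← ENNReal.ofReal_mul this.le, mul_inv_cancel₀ this.ne']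
    simp
  · intro s _ t _ h
    exact Real.exp_injective (mul_left_cancel₀ hk.ne' h)

theorem lintegral_inv_sqrt_mul_eq_lintegral_sinh {k : ℝ} (hk : 0 < k) (g : ℝ → ℝ≥0∞) :
    ∫⁻ y : ℝ, ENNReal.ofReal (√(y ^ 2 + k ^ 2))⁻¹ * g y = ∫⁻ s : ℝ, g (Real.sinh s * k) := by
  have himg : (fun s : ℝ => Real.sinh s * k) '' Set.univ = Set.univ := by
    rw [Set.image_univ, Set.range_eq_univ]
    intro y
    exact ⟨Real.arsinh (y / k), by simp [hk.ne']⟩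
  rw [← setLIntegral_univ, ← himg, lintegral_image_eq_lintegral_abs_deriv_mul MeasurableSet.univ
    (fun s _ => ((Real.hasDerivAt_sinh s).mul_const k).hasDerivWithinAt), Measure.restrict_univ]
  · refine lintegral_congr fun s => ?_
    have hc : 0 < Real.cosh s * k := mul_pos (Real.cosh_pos s) hk
    have : √((Real.sinh s * k) ^ 2 + k ^ 2) = Real.cosh s * k := by
      rw [show (Real.sinh s * k) ^ 2 + k ^ 2 = (Real.cosh s * k) ^ 2 by
        rw [mul_pow, mul_pow, Real.cosh_sq]; ring, Real.sqrt_sq hc.le]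
    rw [this, abs_of_pos hc, ← mul_assoc, ← ENNReal.ofReal_mul hc.le, mul_inv_cancel₀ hc.ne']
    simp
  · intro s _ t _ h
    exact Real.sinh_injective (mul_right_cancel₀ hk.ne' h)

theorem lintegral_Ioi_inv_sqrt_mul_eq_lintegral_sinh (g : ℝ → ℝ≥0∞) :
    ∫⁻ y in Set.Ioi (0 : ℝ), ENNReal.ofReal (√(1 + y ^ 2))⁻¹ * g y =
      ∫⁻ s in Set.Ioi (0 : ℝ), g (Real.sinh s) := by
  have himg : Real.sinh '' Set.Ioi 0 = Set.Ioi 0 := by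
    ext y
    constructor
    · rintro ⟨s, hs, rfl⟩
      exact Real.sinh_pos_iff.2 hs
    · intro hy
      exact ⟨Real.arsinh y, Real.arsinh_pos_iff.2 hy, Real.sinh_arsinh y⟩
  rw [← himg, lintegral_image_eq_lintegral_abs_deriv_mul measurableSet_Ioi
    (fun s _ => (Real.hasDerivAt_sinh s).hasDerivWithinAt), himg]
  · refine lintegral_congr fun s => ?_
    have hc := Real.cosh_pos s
    have : √(1 + Real.sinh s ^ 2) = Real.cosh s := by
      rw [add_comm, ← Real.cosh_sq, Real.sqrt_sq hc.le]
    rw [this, abs_of_pos hc, ← mul_assoc, ← ENNReal.ofReal_mul hc.le, mul_inv_cancel₀ hc.ne']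
    simp
  · exact Real.sinh_injective.injOn

theorem lintegral_eq_lintegral_add_smul {E : Type*} [NormedAddCommGroup E] [NormedSpace ℝ E]
    [MeasurableSpace E] [BorelSpace E] [FiniteDimensional ℝ E] (μ : Measure E)
    [μ.IsAddHaarMeasure] {y : ℝ} (hy : 0 < y) (a : E) {g : E → ℝ≥0∞} (hg : Measurable g) :
    ∫⁻ w, g w ∂μ = ENNReal.ofReal (y ^ Module.finrank ℝ E) * ∫⁻ w, g (a + y • w) ∂μ := by
  have h1 : ∫⁻ w, g (a + y • w) ∂μ = ∫⁻ w, g (a + w) ∂(μ.map (y • ·)) :=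
    (lintegral_map (hg.comp (measurable_const_add a)) (measurable_const_smul y)).symm
  rw [h1, Measure.map_addHaar_smul μ hy.ne', lintegral_smul_measure,
    lintegral_add_left_eq_self, smul_eq_mul, ← mul_assoc, ← ENNReal.ofReal_mul (by positivity),
    abs_of_pos (by positivity), mul_inv_cancel₀ (by positivity)]
  simp

/-! ### Coordinates on hyperbolic space -/

namespace HyperbolicSpace

open EuclideanSpace

variable {m : ℕ} {ϰ : ℝ}

/-- The coordinates of a point of the half-space other than the height. -/
noncomputable def base (x : HyperbolicSpace (m + 1) ϰ) : EuclideanSpace ℝ (Fin m) :=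
  WithLp.toLp 2 fun i => x.point i.castSucc

theorem point_eq_joinLast (x : HyperbolicSpace (m + 1) ϰ) :
    x.point = joinLast (x.height, x.base) := by
  ext i
  refine Fin.lastCases ?_ (fun i => ?_) i
  · rw [joinLast_last]; rfl
  · rw [joinLast_castSucc]; rfl

/-- The point with given base and height. -/
noncomputable def ofHeightBase (ϰ : ℝ) (y : ℝ) (hy : 0 < y) (w : EuclideanSpace ℝ (Fin m)) :
    HyperbolicSpace (m + 1) ϰ :=
  ⟨joinLast (y, w), (joinLast_last (y, w)).symm ▸ hy⟩

@[simp]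
theorem height_ofHeightBase {y : ℝ} (hy : 0 < y) (w : EuclideanSpace ℝ (Fin m)) :
    (ofHeightBase ϰ y hy w).height = y := joinLast_last (y, w)

@[simp]
theorem base_ofHeightBase {y : ℝ} (hy : 0 < y) (w : EuclideanSpace ℝ (Fin m)) :
    (ofHeightBase ϰ y hy w).base = w := by
  ext i
  exact joinLast_castSucc (y, w) i

/-- The point with signed distance `s` along the vertical geodesic through `o`, displaced by `w`
in the orthogonal direction. -/
noncomputable def cylinderPoint (o : HyperbolicSpace (m + 1) ϰ) (s : ℝ)
    (w : EuclideanSpace ℝ (Fin m)) : HyperbolicSpace (m + 1) ϰ :=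
  ofHeightBase ϰ (o.height / √(1 + ‖w‖ ^ 2) * Real.exp s)
    (mul_pos (div_pos o.height_pos (Real.sqrt_pos.2 (by positivity))) (Real.exp_pos s))
    (o.base + (o.height / √(1 + ‖w‖ ^ 2) * Real.exp s) • w)

/-- The space part of the hyperboloid coordinates centred at `o`. -/
noncomputable def hyperboloidMap (o x : HyperbolicSpace (m + 1) ϰ) :
    EuclideanSpace ℝ (Fin (m + 1)) :=
  joinLast ((‖x.base - o.base‖ ^ 2 + x.height ^ 2 - o.height ^ 2) / (2 * o.height * x.height),
    (x.height)⁻¹ • (x.base - o.base))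

theorem sqrt_one_add_norm_hyperboloidMap_sq (o x : HyperbolicSpace (m + 1) ϰ) :
    √(1 + ‖hyperboloidMap o x‖ ^ 2) =
      (‖x.base - o.base‖ ^ 2 + x.height ^ 2 + o.height ^ 2) / (2 * o.height * x.height) := by
  have ho := o.height_pos
  have hx := x.height_pos
  rw [Real.sqrt_eq_iff_mul_self_eq (by positivity) (by positivity), hyperboloidMap,
    norm_joinLast_sq, norm_smul, Real.norm_of_nonneg (by positivity)]
  field_simp
  ring

/-- This is the Minkowski product of the hyperboloid model: √(1 + ‖·‖²) is the time coordinate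
belonging to the space part `hyperboloidMap`. -/
theorem cosh_unitDist_eq_hyperboloidMap (o x z : HyperbolicSpace (m + 1) ϰ) :
    Real.cosh (unitDist x z) =
      √(1 + ‖hyperboloidMap o x‖ ^ 2) * √(1 + ‖hyperboloidMap o z‖ ^ 2) -
        inner ℝ (hyperboloidMap o x) (hyperboloidMap o z) := by
  have ho := o.height_pos
  have hx := x.height_pos
  have hz := z.height_pos
  have h1 : ‖x.point - z.point‖ ^ 2 =
      (x.height - z.height) ^ 2 + (‖x.base - o.base‖ ^ 2 -
        2 * inner ℝ (x.base - o.base) (z.base - o.base) + ‖z.base - o.base‖ ^ 2) := by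
    rw [point_eq_joinLast, point_eq_joinLast, joinLast_sub, norm_joinLast_sq, ← norm_sub_sq_real]
    simp
  rw [cosh_unitDist, sqrt_one_add_norm_hyperboloidMap_sq, sqrt_one_add_norm_hyperboloidMap_sq,
    hyperboloidMap, hyperboloidMap, inner_joinLast, real_inner_smul_left, real_inner_smul_right, h1]
  field_simp
  ring

theorem hyperboloidMap_self (o : HyperbolicSpace (m + 1) ϰ) : hyperboloidMap o o = 0 := by
  have h : ‖hyperboloidMap o o‖ ^ 2 = 0 := by
    rw [hyperboloidMap, norm_joinLast_sq]
    simp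
  simpa using h

theorem cosh_unitDist_origin (o x : HyperbolicSpace (m + 1) ϰ) :
    Real.cosh (unitDist o x) = √(1 + ‖hyperboloidMap o x‖ ^ 2) := by
  rw [cosh_unitDist_eq_hyperboloidMap o o x, hyperboloidMap_self]
  simp

theorem norm_hyperboloidMap (o x : HyperbolicSpace (m + 1) ϰ) :
    ‖hyperboloidMap o x‖ = Real.sinh (unitDist o x) := by
  have h0 := Real.sinh_nonneg_iff.2 (unitDist_nonneg o x)
  rw [← pow_left_inj₀ (norm_nonneg _) h0 two_ne_zero, Real.sinh_sq, cosh_unitDist_origin,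
    Real.sq_sqrt (by positivity)]
  ring

/-- The factor 1/√(1 + ‖w‖²) in the height of `cylinderPoint` is chosen so that the space part takes
this form; it links the half-space and hyperboloid volume elements. -/
theorem hyperboloidMap_cylinderPoint (o : HyperbolicSpace (m + 1) ϰ) (s : ℝ)
    (w : EuclideanSpace ℝ (Fin m)) :
    hyperboloidMap o (cylinderPoint o s w) = joinLast (Real.sinh s * √(1 + ‖w‖ ^ 2), w) := by
  have ho := o.height_pos
  have hs := Real.exp_pos s
  have hk : 0 < √(1 + ‖w‖ ^ 2) := Real.sqrt_pos.2 (by positivity)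
  have hk2 : √(1 + ‖w‖ ^ 2) ^ 2 = 1 + ‖w‖ ^ 2 := Real.sq_sqrt (by positivity)
  rw [hyperboloidMap, cylinderPoint, height_ofHeightBase, base_ofHeightBase, add_sub_cancel_left]
  congr 2
  · rw [norm_smul, Real.norm_of_nonneg (by positivity), Real.sinh_eq, Real.exp_neg]
    have hw : ‖w‖ ^ 2 = √(1 + ‖w‖ ^ 2) ^ 2 - 1 := by rw [hk2]; ring
    rw [mul_pow]
    generalize √(1 + ‖w‖ ^ 2) = k at *
    rw [hw]
    field_simp
    ring
  · rw [smul_smul, inv_mul_cancel₀ (by positivity), one_smul]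

variable [Fact (0 < ϰ)]

theorem measurable_hyperboloidMap (o : HyperbolicSpace (m + 1) ϰ) :
    Measurable (hyperboloidMap o) := by
  have h1 : Measurable (height : HyperbolicSpace (m + 1) ϰ → ℝ) := continuous_height.measurable
  have h2 : Measurable (base : HyperbolicSpace (m + 1) ϰ → EuclideanSpace ℝ (Fin m)) := by
    have : Continuous (base : HyperbolicSpace (m + 1) ϰ → EuclideanSpace ℝ (Fin m)) := by
      refine (PiLp.continuous_toLp 2 _).comp (continuous_pi fun i => ?_)
      exact (EuclideanSpace.proj (𝕜 := ℝ) i.castSucc).continuous.comp continuous_point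
    exact this.measurable
  refine measurable_joinLast.comp (Measurable.prodMk ?_ ?_)
  · exact (((h2.sub_const _).norm.pow_const 2).add (h1.pow_const 2) |>.sub_const _).div
      (h1.const_mul _)
  · exact h1.inv.smul (h2.sub_const _)

/-- In cylindrical coordinates the hyperbolic volume is a multiple of Lebesgue measure. -/
theorem lintegral_hyperbolicVolume_cylinderPoint (o : HyperbolicSpace (m + 1) ϰ)
    {f : HyperbolicSpace (m + 1) ϰ → ℝ≥0∞} (hf : Measurable f) :
    ∫⁻ x, f x ∂hyperbolicVolume (m + 1) ϰ =
      ENNReal.ofReal ((√ϰ)⁻¹ ^ (m + 1)) *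
        ∫⁻ w : EuclideanSpace ℝ (Fin m), ∫⁻ s : ℝ, f (cylinderPoint o s w) := by
  have hϰ : 0 < ϰ := Fact.out
  set g : EuclideanSpace ℝ (Fin (m + 1)) → ℝ≥0∞ := Function.extend point f 0 with hg
  have hgm : Measurable g := measurableEmbedding_point.measurable_extend hf measurable_const
  have hgp : ∀ x : HyperbolicSpace (m + 1) ϰ, g x.point = f x := fun x =>
    point_injective.extend_apply f 0 x
  have hρ : Measurable (volumeDensity ϰ (m + 1)) := by
    unfold volumeDensity
    fun_prop
  have hhalf : MeasurableSet
      {x : EuclideanSpace ℝ (Fin (m + 1)) | 0 < x (Fin.last m)} :=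
    (isOpen_lt continuous_const (EuclideanSpace.proj (𝕜 := ℝ) (Fin.last m)).continuous).measurableSet
  have h1 : ∫⁻ x, f x ∂hyperbolicVolume (m + 1) ϰ =
      ∫⁻ x, {x : EuclideanSpace ℝ (Fin (m + 1)) | 0 < x (Fin.last m)}.indicator
        (fun x => volumeDensity ϰ (m + 1) x * g x) x := by
    rw [hyperbolicVolume_eq_densityVolume, densityVolume]
    simp_rw [← hgp]
    have hrange : Set.range (point : HyperbolicSpace (m + 1) ϰ → _) =
      {x : EuclideanSpace ℝ (Fin (m + 1)) | 0 < x (Fin.last m)} := range_point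
    rw [← lintegral_map hgm measurableEmbedding_point.measurable,
      measurableEmbedding_point.map_comap, hrange, restrict_withDensity hhalf,
      lintegral_withDensity_eq_lintegral_mul _ hρ hgm, ← lintegral_indicator hhalf]
    rfl
  have hmeas : Measurable ({x : EuclideanSpace ℝ (Fin (m + 1)) | 0 < x (Fin.last m)}.indicator
      fun x => volumeDensity ϰ (m + 1) x * g x) := (hρ.mul hgm).indicator hhalf
  rw [h1, lintegral_eq_lintegral_joinLast hmeas]
  have h2 : ∀ y : ℝ, ∫⁻ w : EuclideanSpace ℝ (Fin m),
      {x : EuclideanSpace ℝ (Fin (m + 1)) | 0 < x (Fin.last m)}.indicator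
        (fun x => volumeDensity ϰ (m + 1) x * g x) (joinLast (y, w)) =
      (Set.Ioi (0 : ℝ)).indicator (fun y => ∫⁻ w : EuclideanSpace ℝ (Fin m),
        ENNReal.ofReal ((√ϰ)⁻¹ ^ (m + 1)) *
          (ENNReal.ofReal y⁻¹ * g (joinLast (y, o.base + y • w)))) y := by
    intro y
    by_cases hy : 0 < y
    · rw [Set.indicator_of_mem (show y ∈ Set.Ioi 0 from hy)]
      have hgy : Measurable fun w : EuclideanSpace ℝ (Fin m) => g (joinLast (y, w)) :=
        hgm.comp (measurable_joinLast.comp measurable_prodMk_left)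
      have h3 : ∀ w : EuclideanSpace ℝ (Fin m),
          {x : EuclideanSpace ℝ (Fin (m + 1)) | 0 < x (Fin.last m)}.indicator
            (fun x => volumeDensity ϰ (m + 1) x * g x) (joinLast (y, w)) =
          ENNReal.ofReal ((√ϰ * y)⁻¹ ^ (m + 1)) * g (joinLast (y, w)) := by
        intro w
        rw [Set.indicator_of_mem (by simpa using hy)]
        congr 1
        exact congrArg (fun t => ENNReal.ofReal ((√ϰ * t)⁻¹ ^ (m + 1))) (joinLast_last (y, w))
      have hgy' : Measurable fun w : EuclideanSpace ℝ (Fin m) =>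
          g (joinLast (y, o.base + y • w)) :=
        hgy.comp (measurable_const_add _ |>.comp (measurable_const_smul y))
      simp_rw [h3]
      -- Rescaling the base by the height y contributes the Jacobian y^m, which reduces the density
      -- y^(-(m+1)) to 1/y.
      rw [lintegral_const_mul _ hgy, lintegral_eq_lintegral_add_smul volume hy o.base hgy,
        lintegral_const_mul _ (hgy'.const_mul _), lintegral_const_mul _ hgy', ← mul_assoc,
        ← mul_assoc, ← ENNReal.ofReal_mul (by positivity), ← ENNReal.ofReal_mul (by positivity),
        finrank_euclideanSpace, Fintype.card_fin]
      congr 2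
      have : (√ϰ * y)⁻¹ ^ (m + 1) = (√ϰ)⁻¹ ^ (m + 1) * (y ^ m)⁻¹ * y⁻¹ := by
        rw [mul_inv, mul_pow, pow_succ y⁻¹, inv_pow y]; ring
      rw [this]
      field_simp
    · rw [Set.indicator_of_notMem (show y ∉ Set.Ioi 0 from hy)]
      have : ∀ w : EuclideanSpace ℝ (Fin m),
          {x : EuclideanSpace ℝ (Fin (m + 1)) | 0 < x (Fin.last m)}.indicator
            (fun x => volumeDensity ϰ (m + 1) x * g x) (joinLast (y, w)) = 0 := fun w =>
        Set.indicator_of_notMem (by simpa using hy) _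
      simp [this]
  simp_rw [h2]
  rw [lintegral_indicator measurableSet_Ioi]
  have hmeas : Measurable fun p : ℝ × EuclideanSpace ℝ (Fin m) =>
      ENNReal.ofReal p.1⁻¹ * g (joinLast (p.1, o.base + p.1 • p.2)) := by
    refine Measurable.mul (by fun_prop) (hgm.comp (measurable_joinLast.comp ?_))
    exact measurable_fst.prodMk ((measurable_fst.smul measurable_snd).const_add _)
  rw [lintegral_lintegral_swap (hmeas.const_mul _).aemeasurable]
  have h4 : ∀ w : EuclideanSpace ℝ (Fin m), Measurable fun y : ℝ =>
      ENNReal.ofReal y⁻¹ * g (joinLast (y, o.base + y • w)) := fun w =>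
    hmeas.comp (measurable_prodMk_right (y := w))
  simp_rw [fun w => lintegral_const_mul (μ := volume.restrict (Set.Ioi (0 : ℝ)))
    (ENNReal.ofReal ((√ϰ)⁻¹ ^ (m + 1))) (h4 w)]
  have h5 : ∀ w : EuclideanSpace ℝ (Fin m),
      ∫⁻ y in Set.Ioi (0 : ℝ), ENNReal.ofReal y⁻¹ * g (joinLast (y, o.base + y • w)) =
        ∫⁻ s : ℝ, f (cylinderPoint o s w) := by
    intro w
    -- The measure dy/y is invariant under scaling, so the scale in y = k e^s may depend on w; this
    -- value produces `cylinderPoint`.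
    rw [lintegral_Ioi_inv_mul_eq_lintegral_exp (k := o.height / √(1 + ‖w‖ ^ 2))
      (div_pos o.height_pos (Real.sqrt_pos.2 (by positivity)))]
    exact lintegral_congr fun s => hgp (cylinderPoint o s w)
  rw [lintegral_const_mul]
  · simp_rw [h5]
  · exact Measurable.lintegral_prod_left' (f := fun p : ℝ × EuclideanSpace ℝ (Fin m) =>
      ENNReal.ofReal p.1⁻¹ * g (joinLast (p.1, o.base + p.1 • p.2))) hmeas

end HyperbolicSpace

/-- The hyperboloid volume element in cylindrical coordinates. -/
theorem lintegral_hyperboloid_eq {m : ℕ} {g : EuclideanSpace ℝ (Fin (m + 1)) → ℝ≥0∞}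
    (hg : Measurable g) :
    ∫⁻ x, ENNReal.ofReal (√(1 + ‖x‖ ^ 2))⁻¹ * g x =
      ∫⁻ w : EuclideanSpace ℝ (Fin m), ∫⁻ s : ℝ,
        g (EuclideanSpace.joinLast (Real.sinh s * √(1 + ‖w‖ ^ 2), w)) := by
  have hm : Measurable fun x : EuclideanSpace ℝ (Fin (m + 1)) =>
      ENNReal.ofReal (√(1 + ‖x‖ ^ 2))⁻¹ * g x := Measurable.mul (by fun_prop) hg
  rw [EuclideanSpace.lintegral_eq_lintegral_joinLast hm, lintegral_lintegral_swap
    (f := fun y w => ENNReal.ofReal (√(1 + ‖EuclideanSpace.joinLast (y, w)‖ ^ 2))⁻¹ *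
      g (EuclideanSpace.joinLast (y, w)))
    (hm.comp EuclideanSpace.measurable_joinLast).aemeasurable]
  refine lintegral_congr fun w => ?_
  rw [← lintegral_inv_sqrt_mul_eq_lintegral_sinh (Real.sqrt_pos.2 (by positivity))
    fun y => g (EuclideanSpace.joinLast (y, w))]
  refine lintegral_congr fun y => ?_
  rw [EuclideanSpace.norm_joinLast_sq, Real.sq_sqrt (by positivity)]
  congr 4
  ring

/-- Both sides reduce to the same integral in cylindrical coordinates, so the Jacobian of
`hyperboloidMap` itself is never computed. -/
theorem HyperbolicSpace.lintegral_comp_hyperboloidMap {m : ℕ} {ϰ : ℝ} [Fact (0 < ϰ)]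
    (o : HyperbolicSpace (m + 1) ϰ) {g : EuclideanSpace ℝ (Fin (m + 1)) → ℝ≥0∞}
    (hg : Measurable g) :
    ∫⁻ x, g (hyperboloidMap o x) ∂hyperbolicVolume (m + 1) ϰ =
      ENNReal.ofReal ((√ϰ)⁻¹ ^ (m + 1)) * ∫⁻ x, ENNReal.ofReal (√(1 + ‖x‖ ^ 2))⁻¹ * g x := by
  rw [lintegral_hyperbolicVolume_cylinderPoint o (f := fun x => g (hyperboloidMap o x))
    (hg.comp (measurable_hyperboloidMap o)), lintegral_hyperboloid_eq hg]
  simp_rw [hyperboloidMap_cylinderPoint]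

/-! ### Polar coordinates and the volume of lenses -/

theorem lintegral_fun_norm_addHaar {E : Type*} [NormedAddCommGroup E] [NormedSpace ℝ E]
    [MeasurableSpace E] [BorelSpace E] [FiniteDimensional ℝ E] [Nontrivial E] (μ : Measure E)
    [μ.IsAddHaarMeasure] {f : ℝ → ℝ≥0∞} (hf : Measurable f) :
    ∫⁻ x, f ‖x‖ ∂μ = Module.finrank ℝ E * μ (Metric.ball 0 1) *
      ∫⁻ y in Set.Ioi (0 : ℝ), ENNReal.ofReal (y ^ (Module.finrank ℝ E - 1)) * f y := by
  have hf' : Measurable fun p : Metric.sphere (0 : E) 1 × Set.Ioi (0 : ℝ) => f p.2 :=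
    hf.comp (measurable_subtype_coe.comp measurable_snd)
  have hf'' : Measurable fun y : Set.Ioi (0 : ℝ) => f y := hf.comp measurable_subtype_coe
  calc ∫⁻ x, f ‖x‖ ∂μ = ∫⁻ x : ({(0)}ᶜ : Set E), f ‖x.1‖ ∂(μ.comap (↑)) := by
        rw [lintegral_subtype_comap (measurableSet_singleton _).compl fun x => f ‖x‖,
          restrict_compl_singleton]
    _ = ∫⁻ p, f p.2 ∂μ.toSphere.prod (.volumeIoiPow (Module.finrank ℝ E - 1)) := by
        rw [← μ.measurePreserving_homeomorphUnitSphereProd.lintegral_comp hf']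
        simp
    _ = (∫⁻ y : Set.Ioi (0 : ℝ), f y ∂Measure.volumeIoiPow (Module.finrank ℝ E - 1)) *
          μ.toSphere Set.univ := by
        rw [lintegral_prod _ hf'.aemeasurable]
        dsimp only
        rw [lintegral_const]
    _ = _ := by
        have hm : Measurable fun y : Set.Ioi (0 : ℝ) =>
            ENNReal.ofReal ((y : ℝ) ^ (Module.finrank ℝ E - 1)) := by fun_prop
        rw [μ.toSphere_apply_univ, mul_comm, Measure.volumeIoiPow,
          lintegral_withDensity_eq_lintegral_mul _ hm hf'']
        congr 1
        exact lintegral_subtype_comap measurableSet_Ioi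
          fun y => ENNReal.ofReal (y ^ (Module.finrank ℝ E - 1)) * f y

theorem volume_ball_eq_unitBallVolume {m : ℕ} (hm : m ≠ 0) (r : ℝ) :
    volume (Metric.ball (0 : EuclideanSpace ℝ (Fin m)) r) =
      ENNReal.ofReal (unitBallVolume m) * ENNReal.ofReal r ^ m := by
  have : Nonempty (Fin m) := Fin.pos_iff_nonempty.1 (Nat.pos_of_ne_zero hm)
  have hm' : (0 : ℝ) < m := by positivity
  rw [EuclideanSpace.volume_ball, Fintype.card_fin, mul_comm]
  congr 2
  rw [unitBallVolume, unitSphereArea, Real.Gamma_add_one (by positivity), Real.sqrt_eq_rpow,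
    ← Real.rpow_natCast, ← Real.rpow_mul Real.pi_pos.le]
  have : Real.Gamma ((m : ℝ) / 2) ≠ 0 := (Real.Gamma_pos_of_pos (by positivity)).ne'
  have h2 : (1 / 2 : ℝ) * m = m / 2 := by ring
  rw [h2]
  field_simp

theorem unitSphereArea_nonneg (k : ℕ) : 0 ≤ unitSphereArea k := by
  rw [unitSphereArea]
  have := Real.Gamma_nonneg_of_nonneg (show (0 : ℝ) ≤ (k : ℝ) / 2 by positivity)
  positivity

theorem unitBallVolume_pos {k : ℕ} (hk : k ≠ 0) : 0 < unitBallVolume k := by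
  rw [unitBallVolume, unitSphereArea]
  have hk' : (0 : ℝ) < k := by positivity
  have := Real.Gamma_pos_of_pos (show (0 : ℝ) < (k : ℝ) / 2 by positivity)
  positivity

namespace HyperbolicSpace

variable {m : ℕ} {ϰ : ℝ} [Fact (0 < ϰ)]

/-- Integration of radial functions on hyperbolic space. -/
theorem lintegral_fun_unitDist (o : HyperbolicSpace (m + 1) ϰ) {f : ℝ → ℝ≥0∞}
    (hf : Measurable f) :
    ∫⁻ x, f (unitDist o x) ∂hyperbolicVolume (m + 1) ϰ =
      ENNReal.ofReal ((√ϰ)⁻¹ ^ (m + 1)) * ENNReal.ofReal (unitSphereArea (m + 1)) *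
        ∫⁻ r in Set.Ioi (0 : ℝ), ENNReal.ofReal (Real.sinh r ^ m) * f r := by
  have hf1 : Measurable fun y : ℝ => f (Real.arsinh y) := hf.comp Real.continuous_arsinh.measurable
  have h1 : ∀ x, f (unitDist o x) = f (Real.arsinh ‖hyperboloidMap o x‖) := by
    intro x
    rw [norm_hyperboloidMap, Real.arsinh_sinh]
  simp_rw [h1]
  rw [lintegral_comp_hyperboloidMap o (g := fun Y => f (Real.arsinh ‖Y‖))
    (hf1.comp measurable_norm), mul_assoc]
  congr 1
  rw [lintegral_fun_norm_addHaar volume (E := EuclideanSpace ℝ (Fin (m + 1)))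
    (f := fun y => ENNReal.ofReal (√(1 + y ^ 2))⁻¹ * f (Real.arsinh y))
    (Measurable.mul (by fun_prop) hf1), finrank_euclideanSpace, Fintype.card_fin,
    Nat.add_sub_cancel, volume_ball_eq_unitBallVolume (Nat.succ_ne_zero m)]
  congr 1
  · rw [ENNReal.ofReal_one, one_pow, mul_one, ← ENNReal.ofReal_natCast,
      ← ENNReal.ofReal_mul (by positivity), unitBallVolume]
    congr 1
    field_simp
  · have h2 := lintegral_Ioi_inv_sqrt_mul_eq_lintegral_sinh
      fun y => ENNReal.ofReal (y ^ m) * f (Real.arsinh y)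
    simp_rw [Real.arsinh_sinh] at h2
    rw [← h2]
    exact lintegral_congr fun y => by ring

theorem mem_radialLens_iff_hyperboloidMap {o x z : HyperbolicSpace (m + 1) ϰ} :
    z ∈ radialLens o x ↔
      √(1 + ‖hyperboloidMap o z‖ ^ 2) < Real.cosh (unitDist o x) ∧
        Real.cosh (unitDist o x) * √(1 + ‖hyperboloidMap o z‖ ^ 2) -
          inner ℝ (hyperboloidMap o x) (hyperboloidMap o z) < Real.cosh (unitDist o x) := by
  have hϰ : 0 < ϰ := Fact.out
  have hs : 0 < √ϰ := Real.sqrt_pos.2 hϰ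
  have key : ∀ a b c e : HyperbolicSpace (m + 1) ϰ,
      dist a b < dist c e ↔ Real.cosh (unitDist a b) < Real.cosh (unitDist c e) := by
    intro a b c e
    rw [Real.cosh_lt_cosh, abs_of_nonneg (unitDist_nonneg _ _), abs_of_nonneg (unitDist_nonneg _ _),
      unitDist_eq_sqrt_mul_dist, unitDist_eq_sqrt_mul_dist, mul_lt_mul_iff_right₀ hs]
  rw [mem_radialLens, key, key, cosh_unitDist_origin o z, cosh_unitDist_eq_hyperboloidMap o x z,
    ← cosh_unitDist_origin o x]

end HyperbolicSpace

/-- The image of a lens in hyperboloid coordinates. -/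
def hyperboloidLens {E : Type*} [NormedAddCommGroup E] [InnerProductSpace ℝ E] (r : ℝ) (X : E) :
    Set E :=
  {Y | √(1 + ‖Y‖ ^ 2) < Real.cosh r ∧
    Real.cosh r * √(1 + ‖Y‖ ^ 2) - inner ℝ X Y < Real.cosh r}

theorem isOpen_hyperboloidLens {E : Type*} [NormedAddCommGroup E] [InnerProductSpace ℝ E]
    (r : ℝ) (X : E) : IsOpen (hyperboloidLens r X) :=
  IsOpen.inter (isOpen_lt (f := fun Y : E => √(1 + ‖Y‖ ^ 2)) (by fun_prop) continuous_const)
    (isOpen_lt (f := fun Y : E => Real.cosh r * √(1 + ‖Y‖ ^ 2) - inner ℝ X Y) (by fun_prop)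
      continuous_const)

/-- Rotational symmetry: the reflection that carries X to X' preserves Lebesgue measure, norms and
inner products. It allows the axis of the lens to be placed along the last coordinate. -/
theorem lintegral_hyperboloidLens_eq_of_norm_eq {E : Type*} [NormedAddCommGroup E]
    [InnerProductSpace ℝ E] [FiniteDimensional ℝ E] [MeasurableSpace E] [BorelSpace E] (r : ℝ)
    {X X' : E} (h : ‖X‖ = ‖X'‖) :
    ∫⁻ Y, ENNReal.ofReal (√(1 + ‖Y‖ ^ 2))⁻¹ * (hyperboloidLens r X).indicator 1 Y =
      ∫⁻ Y, ENNReal.ofReal (√(1 + ‖Y‖ ^ 2))⁻¹ * (hyperboloidLens r X').indicator 1 Y := by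
  set R := Submodule.reflection (Submodule.span ℝ {X - X'})ᗮ with hR
  have hRX : R X = X' := Submodule.reflection_sub h
  have hm : Measurable fun Y => ENNReal.ofReal (√(1 + ‖Y‖ ^ 2))⁻¹ *
      (hyperboloidLens r X').indicator (1 : E → ℝ≥0∞) Y :=
    Measurable.mul (by fun_prop)
      (measurable_one.indicator (isOpen_hyperboloidLens r X').measurableSet)
  rw [← R.measurePreserving.lintegral_comp hm]
  refine lintegral_congr fun Y => ?_
  rw [R.norm_map]
  congr 1
  refine Set.indicator_eq_indicator ?_ rfl
  rw [← hRX]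
  simp only [hyperboloidLens, Set.mem_ofPred_eq, R.norm_map, R.inner_map_map]

/-- The squared radius of the section of a lens orthogonal to its axis. -/
noncomputable def lensSection (r s : ℝ) : ℝ :=
  (Real.cosh r / max (Real.cosh s) (Real.cosh (r - s))) ^ 2 - 1

/-- With k = √(1 + ‖w‖²), the cosh of the distances to the two centres are k cosh s and k cosh(r -
s). Both ball conditions together bound k by cosh r over the larger factor, so the slice is a
Euclidean ball in w. -/
theorem joinLast_mem_hyperboloidLens_iff {m : ℕ} {r s : ℝ} {w : EuclideanSpace ℝ (Fin m)} :
    EuclideanSpace.joinLast (Real.sinh s * √(1 + ‖w‖ ^ 2), w) ∈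
        hyperboloidLens r (EuclideanSpace.joinLast (Real.sinh r, (0 : EuclideanSpace ℝ (Fin m)))) ↔
      w ∈ Metric.ball 0 √(lensSection r s) := by
  set k := √(1 + ‖w‖ ^ 2) with hk
  have hk2 : k ^ 2 = 1 + ‖w‖ ^ 2 := Real.sq_sqrt (by positivity)
  have hk0 : 0 < k := Real.sqrt_pos.2 (by positivity)
  have h1 : √(1 + ‖EuclideanSpace.joinLast (Real.sinh s * k, w)‖ ^ 2) = k * Real.cosh s := by
    rw [EuclideanSpace.norm_joinLast_sq,
      show 1 + ((Real.sinh s * k) ^ 2 + ‖w‖ ^ 2) = (k * Real.cosh s) ^ 2 by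
        rw [mul_pow, mul_pow, Real.cosh_sq, hk2]; ring,
      Real.sqrt_sq (mul_nonneg hk0.le (Real.cosh_pos s).le)]
  have hM : 0 < max (Real.cosh s) (Real.cosh (r - s)) := lt_max_of_lt_left (Real.cosh_pos s)
  have hr := Real.cosh_pos r
  have h2 : Real.cosh r * (k * Real.cosh s) - Real.sinh r * (Real.sinh s * k) =
      k * Real.cosh (r - s) := by
    rw [Real.cosh_sub]; ring
  simp only [hyperboloidLens, Set.mem_ofPred_eq]
  rw [h1, EuclideanSpace.inner_joinLast]
  simp only [inner_zero_left, add_zero]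
  rw [h2, mem_ball_zero_iff, Real.lt_sqrt (norm_nonneg w), lensSection, lt_sub_iff_add_lt',
    ← hk2, sq_lt_sq₀ hk0.le (by positivity), lt_div_iff₀ hM, mul_max_of_nonneg _ _ hk0.le, max_lt_iff]

theorem lintegral_hyperboloidLens {m : ℕ} (hm : m ≠ 0) (r : ℝ)
    {X : EuclideanSpace ℝ (Fin (m + 1))} (hX : ‖X‖ = |Real.sinh r|) :
    ∫⁻ Y, ENNReal.ofReal (√(1 + ‖Y‖ ^ 2))⁻¹ * (hyperboloidLens r X).indicator 1 Y =
      ENNReal.ofReal (unitBallVolume m) *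
        ∫⁻ s : ℝ, ENNReal.ofReal √(lensSection r s) ^ m := by
  set X' := EuclideanSpace.joinLast (Real.sinh r, (0 : EuclideanSpace ℝ (Fin m))) with hX'
  have hXX : ‖X‖ = ‖X'‖ := by
    rw [hX, ← pow_left_inj₀ (abs_nonneg _) (norm_nonneg _) two_ne_zero, hX',
      EuclideanSpace.norm_joinLast_sq]
    simp
  have hmL : Measurable ((hyperboloidLens r X').indicator (1 : EuclideanSpace ℝ (Fin (m + 1)) → ℝ≥0∞)) :=
    measurable_one.indicator (isOpen_hyperboloidLens r X').measurableSet
  rw [lintegral_hyperboloidLens_eq_of_norm_eq r hXX, lintegral_hyperboloid_eq hmL]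
  have hjoint : Measurable fun p : EuclideanSpace ℝ (Fin m) × ℝ =>
      (hyperboloidLens r X').indicator (1 : EuclideanSpace ℝ (Fin (m + 1)) → ℝ≥0∞)
        (EuclideanSpace.joinLast (Real.sinh p.2 * √(1 + ‖p.1‖ ^ 2), p.1)) := by
    refine hmL.comp (EuclideanSpace.measurable_joinLast.comp (Measurable.prodMk ?_ measurable_fst))
    exact (Real.measurable_sinh.comp measurable_snd).mul (by fun_prop)
  rw [lintegral_lintegral_swap (f := fun w s => (hyperboloidLens r X').indicator (1 : EuclideanSpace ℝ (Fin (m + 1)) → ℝ≥0∞)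
        (EuclideanSpace.joinLast (Real.sinh s * √(1 + ‖w‖ ^ 2), w))) hjoint.aemeasurable]
  have h1 : ∀ s : ℝ, ∫⁻ w : EuclideanSpace ℝ (Fin m), (hyperboloidLens r X').indicator
        (1 : EuclideanSpace ℝ (Fin (m + 1)) → ℝ≥0∞) (EuclideanSpace.joinLast (Real.sinh s * √(1 + ‖w‖ ^ 2), w)) =
      ENNReal.ofReal (unitBallVolume m) * ENNReal.ofReal √(lensSection r s) ^ m := by
    intro s
    rw [← volume_ball_eq_unitBallVolume hm, ← lintegral_indicator_one Metric.isOpen_ball.measurableSet]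
    exact lintegral_congr fun w => Set.indicator_eq_indicator joinLast_mem_hyperboloidLens_iff rfl
  simp_rw [h1]
  refine lintegral_const_mul _ ?_
  refine Measurable.pow_const (Measurable.ennreal_ofReal (Real.continuous_sqrt.measurable.comp ?_)) m
  have : Continuous (lensSection r) := by
    refine ((continuous_const.div (by fun_prop) fun s => ?_).pow 2).sub continuous_const
    exact (lt_max_of_lt_left (Real.cosh_pos s)).ne'
  exact this.measurable

/-- The symmetry of the lens that exchanges its centres; it accounts for the factor 2 and the upper
limit r/2. -/
theorem lensSection_sub (r s : ℝ) : lensSection r (r - s) = lensSection r s := by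
  rw [lensSection, lensSection, sub_sub_cancel, max_comm]

theorem lensSection_nonpos {r s : ℝ} (hr : 0 ≤ r) (hs : s ≤ 0) : lensSection r s ≤ 0 := by
  have h1 : Real.cosh r ≤ Real.cosh (r - s) := by
    rw [Real.cosh_le_cosh, abs_of_nonneg hr, abs_of_nonneg (by linarith)]
    linarith
  have hM : 0 < max (Real.cosh s) (Real.cosh (r - s)) := lt_max_of_lt_left (Real.cosh_pos s)
  have h2 : Real.cosh r / max (Real.cosh s) (Real.cosh (r - s)) ≤ 1 := by
    rw [div_le_one hM]
    exact h1.trans (le_max_right _ _)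
  have h3 : 0 ≤ Real.cosh r / max (Real.cosh s) (Real.cosh (r - s)) :=
    div_nonneg (Real.cosh_pos r).le hM.le
  rw [lensSection]
  nlinarith

theorem lensSection_eq {r s : ℝ} (hs : 0 ≤ s) (hsr : s ≤ r / 2) :
    lensSection r s = Real.cosh r ^ 2 / Real.cosh (r - s) ^ 2 - 1 := by
  rw [lensSection, max_eq_right, div_pow]
  rw [Real.cosh_le_cosh, abs_of_nonneg hs, abs_of_nonneg (by linarith)]
  linarith

theorem lensSection_nonneg {r s : ℝ} (hs : 0 ≤ s) (hsr : s ≤ r / 2) : 0 ≤ lensSection r s := by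
  rw [lensSection_eq hs hsr, sub_nonneg, one_le_div (pow_pos (Real.cosh_pos _) 2)]
  refine pow_le_pow_left₀ (Real.cosh_pos _).le ?_ 2
  rw [Real.cosh_le_cosh, abs_of_nonneg (by linarith), abs_of_nonneg (by linarith)]
  linarith

theorem continuous_lensIntegrand (m : ℕ) (r : ℝ) : Continuous fun t : ℝ =>
    (Real.cosh r ^ 2 / Real.cosh (r - t) ^ 2 - 1) ^ ((m : ℝ) / 2) := by
  refine Continuous.rpow_const ?_ fun t => Or.inr (by positivity)
  exact (continuous_const.div (by fun_prop) fun t => (pow_pos (Real.cosh_pos _) 2).ne').sub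
    continuous_const

theorem lintegral_lensSection {m : ℕ} (hm : m ≠ 0) {r : ℝ} (hr : 0 ≤ r) :
    ∫⁻ s : ℝ, ENNReal.ofReal √(lensSection r s) ^ m =
      2 * ENNReal.ofReal (∫ t in (0 : ℝ)..(r / 2),
        (Real.cosh r ^ 2 / Real.cosh (r - t) ^ 2 - 1) ^ ((m : ℝ) / 2)) := by
  set q : ℝ → ℝ≥0∞ := fun s => ENNReal.ofReal √(lensSection r s) ^ m with hq
  have hqsym : ∀ s, q (r - s) = q s := fun s => by simp only [hq, lensSection_sub]
  have hsplit := lintegral_add_compl (μ := volume) q (measurableSet_Iic (a := r / 2))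
  have hrefl : ∫⁻ s in (Set.Iic (r / 2))ᶜ, q s = ∫⁻ s in Set.Iic (r / 2), q s := by
    rw [Set.compl_Iic, ← lintegral_indicator measurableSet_Ioi,
      ← lintegral_sub_left_eq_self _ r, setLIntegral_congr Iio_ae_eq_Iic.symm,
      ← lintegral_indicator measurableSet_Iio]
    refine lintegral_congr fun s => ?_
    by_cases hs : s < r / 2
    · rw [Set.indicator_of_mem (show r - s ∈ Set.Ioi (r / 2) by
          rw [Set.mem_Ioi]; linarith), Set.indicator_of_mem (show s ∈ Set.Iio (r / 2) from hs), hqsym]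
    · rw [Set.indicator_of_notMem (show r - s ∉ Set.Ioi (r / 2) by
          rw [Set.mem_Ioi]; linarith), Set.indicator_of_notMem (show s ∉ Set.Iio (r / 2) from hs)]
  have hIoc : ∫⁻ s in Set.Iic (r / 2), q s = ∫⁻ s in Set.Ioc 0 (r / 2), q s := by
    rw [← lintegral_indicator measurableSet_Iic, ← lintegral_indicator measurableSet_Ioc]
    refine lintegral_congr fun s => ?_
    by_cases hs : 0 < s
    · refine Set.indicator_eq_indicator ?_ rfl
      simp [hs]
    -- Behind the centre o the section is empty: the square root takes the value 0 on nonpositive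
    -- numbers, and m ≠ 0 excludes 0^0 = 1.
    · have : q s = 0 := by
        have := lensSection_nonpos hr (not_lt.1 hs)
        simp [hq, Real.sqrt_eq_zero_of_nonpos this, hm]
      rw [Set.indicator_of_notMem (show s ∉ Set.Ioc 0 (r / 2) from fun h => hs h.1)]
      simp [Set.indicator_apply, this]
  rw [← hsplit, hrefl, hIoc, ← two_mul, intervalIntegral.integral_of_le (by linarith),
    ofReal_integral_eq_lintegral_ofReal]
  · congr 1
    refine setLIntegral_congr_fun measurableSet_Ioc fun s hs => ?_
    have h0 := lensSection_nonneg hs.1.le hs.2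
    simp only [hq]
    rw [← ENNReal.ofReal_pow (Real.sqrt_nonneg _), ← lensSection_eq hs.1.le hs.2,
      Real.sqrt_eq_rpow, ← Real.rpow_natCast, ← Real.rpow_mul h0]
    congr 2
    ring
  · exact (continuous_lensIntegrand m r).continuousOn.integrableOn_compact isCompact_Icc
      |>.mono_set Set.Ioc_subset_Icc_self
  · refine (ae_restrict_iff' measurableSet_Ioc).2 (ae_of_all _ fun s hs => ?_)
    have h0 := lensSection_nonneg hs.1.le hs.2
    rw [lensSection_eq hs.1.le hs.2] at h0
    exact Real.rpow_nonneg h0 _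

theorem HyperbolicSpace.hyperbolicVolume_radialLens {m : ℕ} (hm : m ≠ 0) {ϰ : ℝ} [Fact (0 < ϰ)]
    (o x : HyperbolicSpace (m + 1) ϰ) :
    hyperbolicVolume (m + 1) ϰ (radialLens o x) =
      ENNReal.ofReal ((√ϰ)⁻¹ ^ (m + 1) * (2 * unitBallVolume m *
        ∫ t in (0 : ℝ)..(unitDist o x / 2), (Real.cosh (unitDist o x) ^ 2 /
          Real.cosh (unitDist o x - t) ^ 2 - 1) ^ ((m : ℝ) / 2))) := by
  set r := unitDist o x with hr
  have hr0 : 0 ≤ r := unitDist_nonneg o x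
  have hpre : radialLens o x = hyperboloidMap o ⁻¹' hyperboloidLens r (hyperboloidMap o x) :=
    Set.ext fun z => mem_radialLens_iff_hyperboloidMap
  have hL := (isOpen_hyperboloidLens r (hyperboloidMap o x)).measurableSet
  rw [← lintegral_indicator_one (isOpen_radialLens o x).measurableSet, hpre]
  have h1 := lintegral_comp_hyperboloidMap o (g := (hyperboloidLens r (hyperboloidMap o x)).indicator 1)
    (measurable_one.indicator hL)
  have h2 : ‖hyperboloidMap o x‖ = |Real.sinh r| := by
    rw [norm_hyperboloidMap, abs_of_nonneg (Real.sinh_nonneg_iff.2 hr0)]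
  rw [lintegral_hyperboloidLens hm r h2, lintegral_lensSection hm hr0] at h1
  have hκ := (unitBallVolume_pos hm).le
  refine Eq.trans h1 ?_
  rw [ENNReal.ofReal_mul (by positivity), ENNReal.ofReal_mul (by positivity),
    ENNReal.ofReal_mul (by positivity), ENNReal.ofReal_ofNat, mul_left_comm, ← mul_assoc,
    ← mul_assoc, ← mul_assoc]
  ring

/-! ### Growth of the lens volume -/

/-- The volume of a lens as a function of the distance `r` of its two centres, up to a factor. -/
noncomputable def lensIntegral (m : ℕ) (r : ℝ) : ℝ :=
  ∫ t in (0 : ℝ)..(r / 2), (Real.cosh r ^ 2 / Real.cosh (r - t) ^ 2 - 1) ^ ((m : ℝ) / 2)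

theorem continuous_lensIntegral (m : ℕ) : Continuous (lensIntegral m) := by
  refine intervalIntegral.continuous_parametric_intervalIntegral_of_continuous
    (f := fun r t => (Real.cosh r ^ 2 / Real.cosh (r - t) ^ 2 - 1) ^ ((m : ℝ) / 2)) ?_
    (continuous_id.div_const 2)
  refine Continuous.rpow_const ?_ fun p => Or.inr (by positivity)
  refine Continuous.sub (Continuous.div ?_ ?_ fun p => (pow_pos (Real.cosh_pos _) 2).ne')
    continuous_const
  · exact (Real.continuous_cosh.comp continuous_fst).pow 2
  · exact (Real.continuous_cosh.comp (continuous_fst.sub continuous_snd)).pow 2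

theorem lensIntegrand_nonneg (m : ℕ) {r t : ℝ} (ht : 0 ≤ t) (htr : t ≤ r / 2) :
    0 ≤ (Real.cosh r ^ 2 / Real.cosh (r - t) ^ 2 - 1) ^ ((m : ℝ) / 2) := by
  rw [← lensSection_eq ht htr]
  exact Real.rpow_nonneg (lensSection_nonneg ht htr) _

theorem lensIntegral_nonneg (m : ℕ) {r : ℝ} (hr : 0 ≤ r) : 0 ≤ lensIntegral m r :=
  intervalIntegral.integral_nonneg (by linarith) fun _ ht => lensIntegrand_nonneg m ht.1 ht.2

/-- The ratio of the cosh is at least e^t / 2, and t is near r/2, so the integrand is exponentially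
large; a quadratic bound is all that is needed later. The base is at least e^(2t)/8, while e^(2t) ≥
(2t)^4/24 ≥ r^4/384, and 8 · 384 ≤ 64². The condition r ≥ 8 makes the base at least 1, so the
exponent m/2 may be lowered to 1/2. -/
theorem sq_div_le_lensIntegrand {m : ℕ} (hm : m ≠ 0) {r t : ℝ} (hr : 8 ≤ r) (ht : r / 2 - 1 ≤ t)
    (htr : t ≤ r / 2) :
    r ^ 2 / 64 ≤ (Real.cosh r ^ 2 / Real.cosh (r - t) ^ 2 - 1) ^ ((m : ℝ) / 2) := by
  have h1 : Real.exp t / 2 ≤ Real.cosh r / Real.cosh (r - t) := by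
    rw [le_div_iff₀ (Real.cosh_pos _), Real.cosh_eq, Real.cosh_eq]
    have e1 : Real.exp t * Real.exp (r - t) = Real.exp r := by rw [← Real.exp_add]; ring_nf
    have e2 : Real.exp t * Real.exp (-(r - t)) ≤ Real.exp r := by
      rw [← Real.exp_add]; exact Real.exp_le_exp.2 (by linarith)
    have e3 := Real.exp_pos (-r)
    nlinarith
  have h2 : Real.exp (2 * t) / 4 ≤ Real.cosh r ^ 2 / Real.cosh (r - t) ^ 2 := by
    rw [← div_pow]
    calc Real.exp (2 * t) / 4 = (Real.exp t / 2) ^ 2 := by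
          rw [div_pow, ← Real.exp_nat_mul]; norm_num
      _ ≤ _ := pow_le_pow_left₀ (by positivity) h1 2
  have h3 : (2 * t) ^ 4 / 24 ≤ Real.exp (2 * t) := by
    have := Real.pow_div_factorial_le_exp (2 * t) (by linarith) 4
    simpa [Nat.factorial] using this
  have ht2 : r / 2 ≤ 2 * t := by linarith
  have h4 : (r / 2) ^ 4 ≤ (2 * t) ^ 4 := pow_le_pow_left₀ (by linarith) ht2 4
  have h5 : 8 ≤ Real.exp (2 * t) := by
    have : (4 : ℝ) ^ 4 ≤ (r / 2) ^ 4 := pow_le_pow_left₀ (by norm_num) (by linarith) 4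
    linarith
  set b := Real.cosh r ^ 2 / Real.cosh (r - t) ^ 2 - 1 with hb
  have hb1 : (r ^ 2 / 64) ^ 2 ≤ b := by
    have : Real.exp (2 * t) / 8 ≤ b := by linarith
    have e : (r / 2) ^ 4 = r ^ 4 / 16 := by ring
    have e' : (r ^ 2 / 64) ^ 2 = r ^ 4 / 4096 := by ring
    have : 0 ≤ r ^ 4 := by positivity
    linarith
  have hb2 : 1 ≤ b := by
    have : (1 : ℝ) ≤ r ^ 2 / 64 := by nlinarith
    nlinarith
  have hm1 : (1 : ℝ) ≤ m := by exact_mod_cast Nat.one_le_iff_ne_zero.2 hm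
  calc r ^ 2 / 64 ≤ √b := Real.le_sqrt_of_sq_le hb1
    _ = b ^ (1 / 2 : ℝ) := Real.sqrt_eq_rpow b
    _ ≤ b ^ ((m : ℝ) / 2) := Real.rpow_le_rpow_of_exponent_le hb2 (by linarith)

/-- Only the last unit interval before r/2 is used. The -1 makes the bound trivial for r < 8. -/
theorem sq_div_sub_one_le_lensIntegral {m : ℕ} (hm : m ≠ 0) {r : ℝ} (hr : 0 ≤ r) :
    r ^ 2 / 64 - 1 ≤ lensIntegral m r := by
  rcases le_or_gt 8 r with h8 | h8
  · have hIntegrable : ∀ a b : ℝ, IntervalIntegrable (fun t : ℝ =>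
        (Real.cosh r ^ 2 / Real.cosh (r - t) ^ 2 - 1) ^ ((m : ℝ) / 2)) volume a b := fun a b =>
      (continuous_lensIntegrand m r).intervalIntegrable a b
    have h1 : 0 ≤ ∫ t in (0 : ℝ)..(r / 2 - 1),
        (Real.cosh r ^ 2 / Real.cosh (r - t) ^ 2 - 1) ^ ((m : ℝ) / 2) :=
      intervalIntegral.integral_nonneg (by linarith) fun t ht =>
        lensIntegrand_nonneg m ht.1 (by linarith [ht.2])
    have h2 : ∫ _ in (r / 2 - 1)..(r / 2), r ^ 2 / 64 ≤ ∫ t in (r / 2 - 1)..(r / 2),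
        (Real.cosh r ^ 2 / Real.cosh (r - t) ^ 2 - 1) ^ ((m : ℝ) / 2) :=
      intervalIntegral.integral_mono_on (by linarith) (by simp) (hIntegrable _ _) fun t ht =>
        sq_div_le_lensIntegrand hm h8 ht.1 ht.2
    rw [intervalIntegral.integral_const, smul_eq_mul] at h2
    rw [lensIntegral, ← intervalIntegral.integral_add_adjacent_intervals (hIntegrable 0 (r / 2 - 1))
      (hIntegrable (r / 2 - 1) (r / 2))]
    linarith
  · have := lensIntegral_nonneg m hr
    nlinarith

theorem Real.sinh_le_exp (x : ℝ) : Real.sinh x ≤ Real.exp x := by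
  rw [Real.sinh_eq]
  linarith [Real.exp_pos x, Real.exp_pos (-x)]

theorem integrableOn_exp_mul_sinh_pow_mul_exp_lensIntegral {m : ℕ} (hm : m ≠ 0) {c : ℝ}
    (hc : 0 < c) (A : ℝ) :
    IntegrableOn (fun r => Real.exp (A * r) *
      (Real.sinh r ^ m * Real.exp (-(c * lensIntegral m r)))) (Set.Ioi 0) := by
  -- A and m collect the exponential growth of the two prefactors; the extra 1 leaves the integrable
  -- e^(-r).
  set B := A + m + 1 with hB
  have hexp : IntegrableOn (fun r : ℝ => Real.exp (c + 16 * B ^ 2 / c) * Real.exp (-r))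
      (Set.Ioi 0) := (integrableOn_exp_neg_Ioi 0).const_mul _
  refine Integrable.mono' hexp ?_ ?_
  · have := continuous_lensIntegral m
    exact (by fun_prop : Continuous fun r => Real.exp (A * r) *
      (Real.sinh r ^ m * Real.exp (-(c * lensIntegral m r)))).aestronglyMeasurable
  · refine (ae_restrict_iff' measurableSet_Ioi).2 (ae_of_all _ fun r hr => ?_)
    have hr : 0 < r := hr
    have hs : 0 ≤ Real.sinh r := Real.sinh_nonneg_iff.2 hr.le
    rw [Real.norm_of_nonneg (by positivity)]
    have h1 : Real.sinh r ^ m ≤ Real.exp (m * r) := by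
      rw [Real.exp_nat_mul]
      exact pow_le_pow_left₀ hs (Real.sinh_le_exp r) m
    have h2 := sq_div_sub_one_le_lensIntegral hm hr.le
    calc _ ≤ Real.exp (A * r) * (Real.exp (m * r) * Real.exp (-(c * lensIntegral m r))) := by gcongr
      _ = Real.exp (A * r + (m * r + -(c * lensIntegral m r))) := by
          rw [Real.exp_add, Real.exp_add]
      _ ≤ Real.exp (c + 16 * B ^ 2 / c + -r) := by
          refine Real.exp_le_exp.2 ?_
          have h3 : c * (r ^ 2 / 64 - 1) ≤ c * lensIntegral m r := by gcongr
          -- Completing the square: B r is at most c r²/64 + 16 B²/c.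
          have h4 : 0 ≤ c / 64 * (r - 32 * B / c) ^ 2 := by positivity
          have h5 : c / 64 * (r - 32 * B / c) ^ 2 = c * r ^ 2 / 64 - B * r + 16 * B ^ 2 / c := by
            field_simp
            ring
          rw [h5] at h4
          have h6 : B * r = A * r + m * r + r := by rw [hB]; ring
          linarith
      _ = _ := by rw [Real.exp_add]

/-! ### The degree of the origin in hyperbolic space -/

namespace HyperbolicSpace

variable {m : ℕ} {ϰ : ℝ} [Fact (0 < ϰ)]

theorem hyperbolicVolume_ball (o : HyperbolicSpace (m + 1) ϰ) (R : ℝ) :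
    hyperbolicVolume (m + 1) ϰ (Metric.ball o R) =
      ENNReal.ofReal ((√ϰ)⁻¹ ^ (m + 1)) * ENNReal.ofReal (unitSphereArea (m + 1)) *
        ∫⁻ r in Set.Ioo 0 (√ϰ * R), ENNReal.ofReal (Real.sinh r ^ m) := by
  have hϰ : 0 < ϰ := Fact.out
  have h1 : Metric.ball o R = unitDist o ⁻¹' Set.Iio (√ϰ * R) := by
    ext x
    rw [Metric.mem_ball', Set.mem_preimage, Set.mem_Iio, unitDist_eq_sqrt_mul_dist,
      mul_lt_mul_iff_right₀ (Real.sqrt_pos.2 hϰ)]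
  rw [← lintegral_indicator_one Metric.isOpen_ball.measurableSet, h1]
  have h2 := lintegral_fun_unitDist o (f := (Set.Iio (√ϰ * R)).indicator 1)
    (measurable_one.indicator measurableSet_Iio)
  refine Eq.trans h2 ?_
  congr 1
  rw [← Set.Ioi_inter_Iio, Set.inter_comm, ← Measure.restrict_restrict measurableSet_Iio,
    ← lintegral_indicator measurableSet_Iio]
  refine lintegral_congr fun r => ?_
  by_cases hr : r ∈ Set.Iio (√ϰ * R) <;> simp [hr]

theorem hyperbolicVolume_ball_le (o : HyperbolicSpace (m + 1) ϰ) (R : ℝ) :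
    hyperbolicVolume (m + 1) ϰ (Metric.ball o R) ≤
      ENNReal.ofReal ((√ϰ)⁻¹ ^ (m + 1)) * ENNReal.ofReal (unitSphereArea (m + 1)) *
        ENNReal.ofReal (Real.exp ((m + 1) * (√ϰ * R))) := by
  rw [hyperbolicVolume_ball]
  gcongr
  rcases le_or_gt (√ϰ * R) 0 with h0 | h0
  · simp [Set.Ioo_eq_empty (not_lt.2 h0)]
  calc ∫⁻ r in Set.Ioo 0 (√ϰ * R), ENNReal.ofReal (Real.sinh r ^ m)
      ≤ ∫⁻ _ in Set.Ioo 0 (√ϰ * R), ENNReal.ofReal (Real.exp (m * (√ϰ * R))) := by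
        refine setLIntegral_mono' measurableSet_Ioo fun r hr => ENNReal.ofReal_le_ofReal ?_
        rw [Real.exp_nat_mul]
        refine pow_le_pow_left₀ (Real.sinh_nonneg_iff.2 hr.1.le) ?_ m
        exact (Real.sinh_le_exp r).trans (Real.exp_le_exp.2 hr.2.le)
    _ = ENNReal.ofReal (Real.exp (m * (√ϰ * R)) * (√ϰ * R)) := by
        rw [setLIntegral_const, Real.volume_Ioo, sub_zero, ← ENNReal.ofReal_mul (by positivity)]
    _ ≤ _ := by
        refine ENNReal.ofReal_le_ofReal ?_
        rw [add_mul, one_mul, Real.exp_add]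
        gcongr
        -- The length √ϰ R of the interval is absorbed into one more exponential, hence m + 1 in the
        -- exponent.
        linarith [Real.add_one_le_exp (√ϰ * R)]

theorem hyperbolicVolume_ne_top_of_isBounded {B : Set (HyperbolicSpace (m + 1) ϰ)}
    (hB : Bornology.IsBounded B) (o : HyperbolicSpace (m + 1) ϰ) :
    hyperbolicVolume (m + 1) ϰ B ≠ ∞ := by
  obtain ⟨R, hR⟩ := hB.subset_ball o
  exact ne_top_of_le_ne_top (by finiteness) ((measure_mono hR).trans (hyperbolicVolume_ball_le o R))

theorem unitSphereArea_succ_pos (k : ℕ) : 0 < unitSphereArea (k + 1) := by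
  have := unitBallVolume_pos (Nat.succ_ne_zero k)
  rw [unitBallVolume, div_pos_iff_of_pos_right (by positivity)] at this
  exact this

theorem hyperbolicVolume_ball_ne_zero (o : HyperbolicSpace (m + 1) ϰ) {R : ℝ} (hR : 0 < R) :
    hyperbolicVolume (m + 1) ϰ (Metric.ball o R) ≠ 0 := by
  have hϰ : 0 < ϰ := Fact.out
  have hρ : 0 < √ϰ := Real.sqrt_pos.2 hϰ
  rw [hyperbolicVolume_ball]
  have h1 : ENNReal.ofReal ((√ϰ)⁻¹ ^ (m + 1)) ≠ 0 := by
    rw [ENNReal.ofReal_ne_zero_iff]; positivity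
  have h2 : ENNReal.ofReal (unitSphereArea (m + 1)) ≠ 0 := by
    rw [ENNReal.ofReal_ne_zero_iff]; exact unitSphereArea_succ_pos m
  have h3 : ∫⁻ r in Set.Ioo 0 (√ϰ * R), ENNReal.ofReal (Real.sinh r ^ m) ≠ 0 := by
    have hmeas : Measurable fun r : ℝ => ENNReal.ofReal (Real.sinh r ^ m) := by fun_prop
    rw [← pos_iff_ne_zero, setLIntegral_pos_iff hmeas, Set.inter_eq_right.2, Real.volume_Ioo]
    · rw [sub_zero, ENNReal.ofReal_pos]
      exact mul_pos hρ hR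
    · intro r hr
      rw [Function.mem_support, ENNReal.ofReal_ne_zero_iff]
      exact pow_pos (Real.sinh_pos_iff.2 hr.1) m
  exact mul_ne_zero (mul_ne_zero h1 h2) h3

theorem hyperbolicVolume_singleton (o : HyperbolicSpace (m + 1) ϰ) :
    hyperbolicVolume (m + 1) ϰ {o} = 0 := by
  have h := Measure.nullSingletonClass_hausdorff (HyperbolicSpace (m + 1) ϰ)
    (d := ((m + 1 : ℕ) : ℝ)) (by positivity)
  rw [hyperbolicVolume, Measure.euclideanHausdorffMeasure_def, Measure.smul_apply,
    measure_singleton, smul_zero]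

/-- There are arbitrarily many points whose mutual distances exceed their distances to `o`. -/
theorem exists_separated_points (hm : m ≠ 0) (o : HyperbolicSpace (m + 1) ϰ) (n : ℕ) :
    ∃ p : Fin n → HyperbolicSpace (m + 1) ϰ,
      (∀ i j, i ≠ j → dist o (p i) < dist (p i) (p j)) ∧ ∀ i, p i ≠ o := by
  have hϰ : 0 < ϰ := Fact.out
  have hρ : 0 < √ϰ := Real.sqrt_pos.2 hϰ
  have ho := o.height_pos
  -- The points lie at the low height δ · `o.height`, with bases spaced by `o.height`. The distance
  -- comparison becomes (1 - δ)² + i² < (i - j)²/δ, and 1/δ = n² + 2 exceeds the left side.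
  set δ : ℝ := ((n : ℝ) ^ 2 + 2)⁻¹ with hδ
  have hδ0 : 0 < δ := by positivity
  have hδ1 : δ * ((n : ℝ) ^ 2 + 2) = 1 := inv_mul_cancel₀ (by positivity)
  set e : EuclideanSpace ℝ (Fin m) :=
    EuclideanSpace.single ⟨0, Nat.pos_of_ne_zero hm⟩ (1 : ℝ) with he
  have he1 : ‖e‖ = 1 := by simp [he]
  have hh : 0 < o.height * δ := by positivity
  refine ⟨fun i => ofHeightBase ϰ (o.height * δ) hh (o.base + (o.height * (i : ℝ)) • e),
    fun i j hij => ?_, fun i h => ?_⟩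
  · rw [← mul_lt_mul_iff_right₀ hρ, ← unitDist_eq_sqrt_mul_dist, ← unitDist_eq_sqrt_mul_dist,
      ← abs_of_nonneg (unitDist_nonneg o _),
      ← abs_of_nonneg (unitDist_nonneg (ofHeightBase ϰ (o.height * δ) hh _) _),
      ← Real.cosh_lt_cosh, cosh_unitDist, cosh_unitDist, point_eq_joinLast o]
    simp only [point_eq_joinLast (ofHeightBase ϰ _ _ _), height_ofHeightBase, base_ofHeightBase,
      EuclideanSpace.joinLast_sub, EuclideanSpace.norm_joinLast_sq, Prod.mk_sub_mk]
    rw [sub_add_cancel_left, add_sub_add_left_eq_sub, ← sub_smul, norm_neg, norm_smul, norm_smul,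
      he1, sub_self, mul_one, mul_one, Real.norm_eq_abs, Real.norm_eq_abs, sq_abs, sq_abs]
    have hij1 : 1 ≤ ((i : ℝ) - (j : ℝ)) ^ 2 := by
      have hne : ((i : ℕ) : ℤ) - ((j : ℕ) : ℤ) ≠ 0 := by
        rw [sub_ne_zero]
        exact_mod_cast fun h => hij (Fin.ext h)
      have : (1 : ℤ) ≤ (((i : ℕ) : ℤ) - ((j : ℕ) : ℤ)) ^ 2 := by
        have := sq_pos_of_ne_zero hne
        lia
      exact_mod_cast this
    have hi : ((i : ℕ) : ℝ) ^ 2 ≤ (n : ℝ) ^ 2 := by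
      have : ((i : ℕ) : ℝ) ≤ n := by exact_mod_cast i.2.le
      gcongr
    have e1 : ((o.height - o.height * δ) ^ 2 + (o.height * (i : ℝ)) ^ 2) /
        (2 * o.height * (o.height * δ)) = ((1 - δ) ^ 2 + (i : ℝ) ^ 2) / (2 * δ) := by
      field_simp
    have e2 : ((0 : ℝ) ^ 2 + (o.height * (i : ℝ) - o.height * (j : ℝ)) ^ 2) /
        (2 * (o.height * δ) * (o.height * δ)) = ((i : ℝ) - (j : ℝ)) ^ 2 / δ / (2 * δ) := by
      field_simp
      ring
    rw [e1, e2]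
    gcongr
    rw [lt_div_iff₀ hδ0]
    have hδle : δ ≤ 1 := by nlinarith [sq_nonneg (n : ℝ)]
    have h1 : (1 - δ) ^ 2 ≤ 1 := by nlinarith
    nlinarith
  · have := congrArg height h
    rw [height_ofHeightBase] at this
    have hδ' : δ = 1 := by
      have : o.height * δ = o.height * 1 := by linarith
      exact mul_left_cancel₀ ho.ne' this
    rw [hδ'] at hδ1
    nlinarith [sq_nonneg (n : ℝ)]

end HyperbolicSpace

theorem Real.rpow_neg_natCast_div_two {ϰ : ℝ} (hϰ : 0 ≤ ϰ) (d : ℕ) :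
    ϰ ^ (-(d : ℝ) / 2) = (√ϰ)⁻¹ ^ d := by
  rw [Real.sqrt_eq_rpow, ← Real.rpow_neg hϰ, ← Real.rpow_natCast, ← Real.rpow_mul hϰ]
  congr 1
  ring

theorem expectedDegreeIntegrand_succ (m : ℕ) {ϰ : ℝ} (hϰ : 0 ≤ ϰ) (γ r : ℝ) :
    expectedDegreeIntegrand (m + 1) ϰ γ r = Real.sinh r ^ m *
      Real.exp (-(2 * γ * unitBallVolume m * (√ϰ)⁻¹ ^ (m + 1) * lensIntegral m r)) := by
  rw [expectedDegreeIntegrand, Real.rpow_neg_natCast_div_two hϰ, Nat.add_sub_cancel, lensIntegral]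
  push_cast
  rw [add_sub_cancel_right]

namespace HyperbolicSpace

variable {m : ℕ} {ϰ : ℝ} [Fact (0 < ϰ)]

theorem lintegral_fun_unitDist_smul (o : HyperbolicSpace (m + 1) ϰ) {γ : ℝ} (hγ : 0 < γ)
    {f : ℝ → ℝ} (hf : Measurable f) :
    ∫⁻ x, ENNReal.ofReal (f (unitDist o x)) ∂(ENNReal.ofReal γ • hyperbolicVolume (m + 1) ϰ) =
      ENNReal.ofReal (γ * unitSphereArea (m + 1) * (√ϰ)⁻¹ ^ (m + 1)) *
        ∫⁻ r in Set.Ioi (0 : ℝ), ENNReal.ofReal (Real.sinh r ^ m * f r) := by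
  have h0 := unitSphereArea_nonneg (m + 1)
  rw [lintegral_smul_measure, lintegral_fun_unitDist o (f := fun r => ENNReal.ofReal (f r))
    hf.ennreal_ofReal, smul_eq_mul, ENNReal.ofReal_mul (by positivity),
    ENNReal.ofReal_mul hγ.le, mul_assoc, mul_assoc, mul_left_comm (ENNReal.ofReal ((√ϰ)⁻¹ ^ (m + 1))),
    mul_assoc]
  congr 3
  refine setLIntegral_congr_fun measurableSet_Ioi fun r hr => ?_
  exact (ENNReal.ofReal_mul (pow_nonneg (Real.sinh_nonneg_iff.2 (le_of_lt hr)) m)).symm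

theorem poissonLaw_radialLens (hm : m ≠ 0) {γ : ℝ} (hγ : 0 < γ) (o x : HyperbolicSpace (m + 1) ϰ) :
    poissonLaw ((ENNReal.ofReal γ • hyperbolicVolume (m + 1) ϰ) (radialLens o x)) {0} =
      ENNReal.ofReal (Real.exp (-(2 * γ * unitBallVolume m * (√ϰ)⁻¹ ^ (m + 1) *
        lensIntegral m (unitDist o x)))) := by
  have hκ := (unitBallVolume_pos hm).le
  have hl := lensIntegral_nonneg m (unitDist_nonneg o x)
  have h : (ENNReal.ofReal γ • hyperbolicVolume (m + 1) ϰ) (radialLens o x) =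
      ENNReal.ofReal (2 * γ * unitBallVolume m * (√ϰ)⁻¹ ^ (m + 1) *
        lensIntegral m (unitDist o x)) := by
    rw [Measure.smul_apply, smul_eq_mul, hyperbolicVolume_radialLens hm,
      ← ENNReal.ofReal_mul hγ.le]
    congr 1
    rw [lensIntegral]
    ring
  rw [h, poissonLaw_singleton_zero ENNReal.ofReal_ne_top, ENNReal.toReal_ofReal (by positivity)]

/-- Since A is arbitrary, the exponential weight can absorb the powers a^k attached to the shells in
the moment estimate. -/
theorem lintegral_exp_mul_void_ne_top (hm : m ≠ 0) {γ : ℝ} (hγ : 0 < γ)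
    (o : HyperbolicSpace (m + 1) ϰ) (A : ℝ) :
    ∫⁻ x, ENNReal.ofReal (Real.exp (A * unitDist o x)) *
      poissonLaw ((ENNReal.ofReal γ • hyperbolicVolume (m + 1) ϰ) (radialLens o x)) {0}
        ∂(ENNReal.ofReal γ • hyperbolicVolume (m + 1) ϰ) ≠ ∞ := by
  have hϰ : 0 < ϰ := Fact.out
  have hρ : 0 < √ϰ := Real.sqrt_pos.2 hϰ
  have hκ := unitBallVolume_pos hm
  set c := 2 * γ * unitBallVolume m * (√ϰ)⁻¹ ^ (m + 1) with hc
  have hc0 : 0 < c := by positivity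
  simp_rw [poissonLaw_radialLens hm hγ, ← ENNReal.ofReal_mul (Real.exp_nonneg _)]
  rw [lintegral_fun_unitDist_smul o hγ
    (f := fun r => Real.exp (A * r) * Real.exp (-(c * lensIntegral m r)))
    (by have := continuous_lensIntegral m; fun_prop)]
  have h1 := (integrableOn_exp_mul_sinh_pow_mul_exp_lensIntegral hm hc0 A).lintegral_lt_top
  refine ENNReal.mul_ne_top ENNReal.ofReal_ne_top (ne_of_lt ?_)
  convert! h1 using 4
  ring

theorem tsum_pow_mul_void_ne_top (hm : m ≠ 0) {γ : ℝ} (hγ : 0 < γ)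
    (o : HyperbolicSpace (m + 1) ϰ) {a : ℝ≥0∞} (ha : a ≠ ∞) :
    ∑' k : ℕ, a ^ k * ∫⁻ x in radialShell o k,
      poissonLaw ((ENNReal.ofReal γ • hyperbolicVolume (m + 1) ϰ) (radialLens o x)) {0}
        ∂(ENNReal.ofReal γ • hyperbolicVolume (m + 1) ϰ) ≠ ∞ := by
  have hϰ : 0 < ϰ := Fact.out
  have hρ : 0 < √ϰ := Real.sqrt_pos.2 hϰ
  -- Bounding a below by 1 makes A nonnegative, so that A times the distance is monotone; A is
  -- chosen so that exp(A √ϰ k) = b^k.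
  set b := max a.toReal 1 with hb
  have hb1 : 1 ≤ b := le_max_right _ _
  set A := Real.log b / √ϰ with hA
  have hA0 : 0 ≤ A := div_nonneg (Real.log_nonneg hb1) hρ.le
  set μ := ENNReal.ofReal γ • hyperbolicVolume (m + 1) ϰ with hμ
  have hk : ∀ (k : ℕ), ∀ x ∈ radialShell o k, a ^ k ≤ ENNReal.ofReal (Real.exp (A * unitDist o x)) := by
    intro k x hx
    have h1 : a ≤ ENNReal.ofReal b := by
      rw [← ENNReal.ofReal_toReal ha]
      exact ENNReal.ofReal_le_ofReal (le_max_left _ _)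
    refine (pow_le_pow_left' h1 k).trans ?_
    rw [← ENNReal.ofReal_pow (by positivity)]
    refine ENNReal.ofReal_le_ofReal ?_
    calc b ^ k = Real.exp (k * Real.log b) := by
          rw [Real.exp_nat_mul, Real.exp_log (by positivity)]
      _ = Real.exp (A * (√ϰ * k)) := by
          congr 1
          rw [hA]
          field_simp
      _ ≤ _ := by
          rw [unitDist_eq_sqrt_mul_dist]
          gcongr
          exact hx.2.1
  refine ne_top_of_le_ne_top (lintegral_exp_mul_void_ne_top hm hγ o A) ?_
  calc _ ≤ ∑' k : ℕ, ∫⁻ x in radialShell o k, ENNReal.ofReal (Real.exp (A * unitDist o x)) *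
        poissonLaw (μ (radialLens o x)) {0} ∂μ := by
        refine ENNReal.tsum_le_tsum fun k => ?_
        rw [← lintegral_const_mul' _ _ (by finiteness)]
        refine setLIntegral_mono' (measurableSet_radialShell o k) fun x hx => ?_
        gcongr
        exact hk k x hx
    _ = ∫⁻ x in ⋃ k, radialShell o k, ENNReal.ofReal (Real.exp (A * unitDist o x)) *
        poissonLaw (μ (radialLens o x)) {0} ∂μ :=
        (lintegral_iUnion (measurableSet_radialShell o) (pairwise_disjoint_radialShell o) _).symm
    _ ≤ _ := setLIntegral_le_lintegral _ _

theorem exists_smul_hyperbolicVolume_ball_le (γ : ℝ) (o : HyperbolicSpace (m + 1) ϰ) :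
    ∃ C q : ℝ≥0∞, C ≠ ∞ ∧ q ≠ ∞ ∧ q ≠ 0 ∧ ∀ k : ℕ,
      (ENNReal.ofReal γ • hyperbolicVolume (m + 1) ϰ) (Metric.ball o (k + 1)) + 1 ≤ C * q ^ k := by
  set q := ENNReal.ofReal (Real.exp ((m + 1) * √ϰ)) with hq
  have hq1 : 1 ≤ q := by
    rw [hq, ENNReal.one_le_ofReal]
    exact Real.one_le_exp (by positivity)
  set D := ENNReal.ofReal γ * (ENNReal.ofReal ((√ϰ)⁻¹ ^ (m + 1)) *
    ENNReal.ofReal (unitSphereArea (m + 1))) with hD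
  refine ⟨(D + 1) * q, q, by finiteness, by finiteness, (zero_lt_one.trans_le hq1).ne', fun k => ?_⟩
  have hqk : ENNReal.ofReal (Real.exp ((m + 1) * (√ϰ * ((k : ℝ) + 1)))) = q ^ (k + 1) := by
    rw [hq, ← ENNReal.ofReal_pow (Real.exp_nonneg _), ← Real.exp_nat_mul]
    congr 2
    push_cast
    ring
  calc _ ≤ D * q ^ (k + 1) + q ^ (k + 1) := by
        refine add_le_add ?_ (one_le_pow₀ hq1)
        rw [Measure.smul_apply, smul_eq_mul, hD, ← hqk, mul_assoc]
        gcongr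
        exact hyperbolicVolume_ball_le o _
    _ = _ := by ring

theorem lintegral_originDegree_eq (hm : m ≠ 0) {γ : ℝ} (hγ : 0 < γ)
    (o : HyperbolicSpace (m + 1) ϰ) {Ω : Type*} [MeasurableSpace Ω] {P : Measure Ω}
    {η : Ω → Set (HyperbolicSpace (m + 1) ϰ)}
    (hη : IsPoissonProcess η (ENNReal.ofReal γ • hyperbolicVolume (m + 1) ϰ) P) :
    IntegrableOn (expectedDegreeIntegrand (m + 1) ϰ γ) (Set.Ioi 0) ∧
      ∫⁻ ω, (originDegree o (η ω) : ℝ≥0∞) ∂P =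
        ENNReal.ofReal (γ * unitSphereArea (m + 1) * (√ϰ)⁻¹ ^ (m + 1) *
          ∫ r in Set.Ioi (0 : ℝ), expectedDegreeIntegrand (m + 1) ϰ γ r) := by
  have hϰ : 0 < ϰ := Fact.out
  have hρ : 0 < √ϰ := Real.sqrt_pos.2 hϰ
  have hκ := unitBallVolume_pos hm
  have hω := unitSphereArea_nonneg (m + 1)
  set c := 2 * γ * unitBallVolume m * (√ϰ)⁻¹ ^ (m + 1) with hc
  have hc0 : 0 < c := by positivity
  have hfun : expectedDegreeIntegrand (m + 1) ϰ γ = fun r => Real.sinh r ^ m *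
      Real.exp (-(c * lensIntegral m r)) :=
    funext fun r => expectedDegreeIntegrand_succ m hϰ.le γ r
  have hIntegrable : IntegrableOn (expectedDegreeIntegrand (m + 1) ϰ γ) (Set.Ioi 0) := by
    rw [hfun]
    simpa using integrableOn_exp_mul_sinh_pow_mul_exp_lensIntegral hm hc0 0
  refine ⟨hIntegrable, ?_⟩
  have hnn : 0 ≤ᵐ[volume.restrict (Set.Ioi (0 : ℝ))] expectedDegreeIntegrand (m + 1) ϰ γ := by
    refine (ae_restrict_iff' measurableSet_Ioi).2 (ae_of_all _ fun r hr => ?_)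
    rw [hfun]
    exact mul_nonneg (pow_nonneg (Real.sinh_nonneg_iff.2 (le_of_lt hr)) m) (Real.exp_nonneg _)
  have hfin : ∀ B : Set (HyperbolicSpace (m + 1) ϰ), Bornology.IsBounded B →
      (ENNReal.ofReal γ • hyperbolicVolume (m + 1) ϰ) B ≠ ∞ := fun B hB => by
    rw [Measure.smul_apply, smul_eq_mul]
    exact ENNReal.mul_ne_top ENNReal.ofReal_ne_top (hyperbolicVolume_ne_top_of_isBounded hB o)
  have hnull : (ENNReal.ofReal γ • hyperbolicVolume (m + 1) ϰ) {o} = 0 := by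
    rw [Measure.smul_apply, hyperbolicVolume_singleton, smul_zero]
  -- Points have measure zero, so excluding o from the Mecke integral changes nothing.
  have hae : ({o}ᶜ : Set (HyperbolicSpace (m + 1) ϰ)) =ᵐ[ENNReal.ofReal γ •
      hyperbolicVolume (m + 1) ϰ] Set.univ := by
    rw [ae_eq_univ, compl_compl]
    exact hnull
  rw [hη.lintegral_originDegree hfin o, setLIntegral_congr hae, setLIntegral_univ]
  simp_rw [poissonLaw_radialLens hm hγ]
  rw [lintegral_fun_unitDist_smul o hγ (f := fun r => Real.exp (-(c * lensIntegral m r)))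
    (by have := continuous_lensIntegral m; fun_prop),
    ENNReal.ofReal_mul (p := γ * unitSphereArea (m + 1) * (√ϰ)⁻¹ ^ (m + 1)) (by positivity),
    ofReal_integral_eq_lintegral_ofReal hIntegrable hnn, hfun]

end HyperbolicSpace

theorem theorem1p1 (d : ℕ) [NeZero d] (hd : 2 ≤ d) (ϰ : ℝ) [Fact (0 < ϰ)] (γ : ℝ) (hγ : 0 < γ)
    (o : HyperbolicSpace d ϰ)
    {Ω : Type*} [MeasurableSpace Ω] (P : Measure Ω) [IsProbabilityMeasure P]
    (η : Ω → Set (HyperbolicSpace d ϰ))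
    (hη : IsPoissonProcess η (ENNReal.ofReal γ • hyperbolicVolume d ϰ) P) :
    Measurable (fun ω => originDegree o (η ω)) ∧
    (∀ n : ℕ, ∫⁻ ω, (originDegree o (η ω) : ℝ≥0∞) ^ n ∂P < ∞) ∧
    (IntegrableOn (expectedDegreeIntegrand d ϰ γ) (Set.Ioi 0) ∧
      ∫⁻ ω, (originDegree o (η ω) : ℝ≥0∞) ∂P =
        ENNReal.ofReal (γ * unitSphereArea d * ϰ ^ (-(d : ℝ) / 2) *
          ∫ r in Set.Ioi (0 : ℝ), expectedDegreeIntegrand d ϰ γ r)) ∧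
    (∀ n : ℕ, 0 < P {ω | (n : ℕ∞) ≤ originDegree o (η ω)}) := by
  -- Here m = d - 1 is the dimension of the slices of the lens; d ≥ 2 makes it positive.
  obtain ⟨m, rfl⟩ : ∃ m, d = m + 1 := ⟨d - 1, by lia⟩
  have hm : m ≠ 0 := by lia
  have hϰ : 0 < ϰ := Fact.out
  have hfin : ∀ B : Set (HyperbolicSpace (m + 1) ϰ), Bornology.IsBounded B →
      (ENNReal.ofReal γ • hyperbolicVolume (m + 1) ϰ) B ≠ ∞ := fun B hB => by
    rw [Measure.smul_apply, smul_eq_mul]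
    exact ENNReal.mul_ne_top ENNReal.ofReal_ne_top
      (HyperbolicSpace.hyperbolicVolume_ne_top_of_isBounded hB o)
  refine ⟨hη.measurable_originDegree o, fun n => ?_, ?_, fun n => ?_⟩
  · obtain ⟨C, q, hC, hq, hq0, hball⟩ := HyperbolicSpace.exists_smul_hyperbolicVolume_ball_le γ o
    exact hη.lintegral_originDegree_pow_lt_top hfin o hC hq hq0 hball
      (fun a ha => HyperbolicSpace.tsum_pow_mul_void_ne_top hm hγ o ha) n
  · rw [Real.rpow_neg_natCast_div_two hϰ.le]
    exact HyperbolicSpace.lintegral_originDegree_eq hm hγ o hη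
  · obtain ⟨p, hsep, hpo⟩ := HyperbolicSpace.exists_separated_points hm o n
    refine hη.measure_le_originDegree_pos hfin (fun x r hr => ?_) p hsep hpo
    rw [Measure.smul_apply, smul_eq_mul]
    refine mul_ne_zero ?_ (HyperbolicSpace.hyperbolicVolume_ball_ne_zero x hr)
    rw [ENNReal.ofReal_ne_zero_iff]
    exact hγ
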